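/- Let $\Lambda\subset\mathbb C$ be a lattice (with $\mathbb R$-linearly independent generators $2\omega_1,2\omega_2$), let $\wp,\zeta,\sigma$ be its Weierstrass functions, $g_2,g_3$ its invariants, and let $a_n$ be defined by $\wp(z)=z^{-2}+\sum_{n\ge 0}a_nz^n$ near $z=0$. Let $\mathcal A$ be the algebra of holomorphic functions of $x\in\mathbb C\setminus\Lambda$ and $\mathcal E$ the ring of formal pseudo-differential operators $\sum_{n\ll+\infty}b_n\partial_x^n$, $b_n\in\mathcal A$, with product given by the generalized Leibniz rule $(b\,\partial_x^i)(c\,\partial_x^j)=\sum_{r\ge0}\binom{i}{r}\,b\,\partial_x^r(c)\,\partial_x^{i+j-r}$; let $(\cdot)_{\ge 0}$ denote the projection that keeps the terms with $n\ge 0$. There is exactly one sequence $(v_n)_{n\ge0}$ in $\mathcal A$ such that for every $x\in\mathbb C\setminus\Lambda$ and all sufficiently large $|\lambda|$ $$\frac{\sigma(x-\lambda^{-1})}{\sigma(x)}\,e^{(\zeta(\lambda^{-1})-\lambda)x}=\sum_{n\ge0}v_n(x)\lambda^{-n},$$ and $v_0=1$. The operator $V_0=1+\sum_{n\ge1}v_n\partial_x^{-n}$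 is invertible in $\mathcal E$, and $L_0=V_0\,\partial_x\,V_0^{-1}$ is a stationary solution of the KP hierarchy: it has the form $L_0=\partial_x+\sum_{j\ge1}u_{j+1}\partial_x^{-j}$ and $$\left[(L_0^{n+2})_{\ge0},\,L_0\right]=0\qquad(n=0,1,2,\dots).$$ Moreover, for all $n\ge0$, $$(L_0^{n+2})_{\ge0}=\tilde P_{n+2}-\frac{a_n}{n+1}=V_0U_{n+2}V_0^{-1}-\frac{a_n}{n+1},$$ where $$U_{n+2}=\partial_x^{n+2}+\frac{a_n}{n+1}+\sum_{m\ge1}\frac{(-1)^m(m+n)!}{m!\,(n+1)!}\,a_{m+n}\,\partial_x^{-m}$$ has constant coefficients, and the differential operators $\tilde P_n$ $(n\ge2)$ are defined for $m\ge0$ by $$\tilde P_{2m+2}=P_{2m+2}+\sum_{j=1}^{m-1}r_{m,j}P_{2j}+r_{m,0},\qquad \tilde P_{2m+3}=P_{2m+3}+\sum_{j=1}^{m-1}\frac{j\,r_{m,j}}{m+1}P_{2j+1}.$$ Here $P_2=\partial_x^2-2\wp$, $Q_1=\wp\,\partial_x-\tfrac12\wp'$, $P_{n+1}=P_n\partial_x+P_n'-Q_{n-1}$,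 $Q_n=2\wp P_n-Q_{n-1}\partial_x-Q_{n-1}'$ for $n\ge2$ (a prime on an operator differentiates its coefficients), and $r_{m,j}$ is the coefficient of $X^j$ in $R_m/(2m+1)!$, where $R_0=X$ and $R_{m+1}=(6X^2-\tfrac{g_2}{2})R_m'+(4X^3-g_2X-g_3)R_m''$. -/

import Mathlib

noncomputable section

/-! ## Formal pseudo-differential operators -/

/-- Formal pseudo-differential operators `∑_{n ≪ +∞} a_n ∂ⁿ` over a commutative differential
algebra `(A, D)`: families of coefficients `a_n`, `n ∈ ℤ`, vanishing for all large `n`. -/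
structure PseudoDiffOp {k A : Type*} [CommRing k] [CommRing A] [Algebra k A]
    (D : Derivation k A A) where
  /-- the coefficient of `∂ⁿ`, written to the left of `∂ⁿ` -/
  coeff : ℤ → A
  bounded : ∃ N : ℤ, ∀ n, N < n → coeff n = 0

namespace PseudoDiffOp

variable {k A : Type*} [CommRing k] [CommRing A] [Algebra k A] {D : Derivation k A A}

theorem ext_coeff {P Q : PseudoDiffOp D} (h : ∀ n, P.coeff n = Q.coeff n) : P = Q := by
  cases P; cases Q; congr; exact funext h

instance : Zero (PseudoDiffOp D) := ⟨⟨fun _ => 0, 0, fun _ _ => rfl⟩⟩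

instance : Add (PseudoDiffOp D) := ⟨fun P Q => ⟨fun n => P.coeff n + Q.coeff n, by
  obtain ⟨N, hN⟩ := P.bounded
  obtain ⟨M, hM⟩ := Q.bounded
  exact ⟨max N M, fun n hn => by
    rw [hN n (lt_of_le_of_lt (le_max_left _ _) hn), hM n (lt_of_le_of_lt (le_max_right _ _) hn),
      add_zero]⟩⟩⟩

instance : Neg (PseudoDiffOp D) := ⟨fun P => ⟨fun n => -P.coeff n, by
  obtain ⟨N, hN⟩ := P.bounded
  exact ⟨N, fun n hn => by rw [hN n hn, neg_zero]⟩⟩⟩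

/-- The operator `a ∂ⁿ`. -/
def monomial (D : Derivation k A A) (a : A) (n : ℤ) : PseudoDiffOp D :=
  ⟨fun m => if m = n then a else 0, n, fun _ h => if_neg (ne_of_gt h)⟩

/-- The operator of multiplication by `a`. -/
def mulBy (D : Derivation k A A) (a : A) : PseudoDiffOp D := monomial D a 0

/-- The operator `∂`. -/
def del (D : Derivation k A A) : PseudoDiffOp D := monomial D 1 1

instance : One (PseudoDiffOp D) := ⟨mulBy D 1⟩

/-- The terms of the product of two operators of order at most `N` and `M` in degree `n` are
all of the form below. -/
theorem mul_support (P Q : PseudoDiffOp D) {N M : ℤ} (hN : ∀ n, N < n → P.coeff n = 0)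
    (hM : ∀ n, M < n → Q.coeff n = 0) (n : ℤ) (p : ℤ × ℕ)
    (hp : Ring.choose p.1 p.2 • (P.coeff p.1 * D^[p.2] (Q.coeff (n - p.1 + p.2))) ≠ 0) :
    p.1 ≤ N ∧ n - p.1 + p.2 ≤ M := by
  constructor
  · by_contra h
    apply hp
    rw [hN _ (not_le.mp h), zero_mul, smul_zero]
  · by_contra h
    apply hp
    rw [hM _ (not_le.mp h), iterate_map_zero, mul_zero, smul_zero]

/-- The product given by the generalized Leibniz rule
`(a ∂ⁱ) (b ∂ʲ) = ∑_r (i choose r) a D^r(b) ∂^(i+j-r)`: in degree `n`, the sum runs over all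
`(i, r)` with `j = n - i + r`, and only finitely many terms are nonzero. -/
instance : Mul (PseudoDiffOp D) := ⟨fun P Q =>
  ⟨fun n => ∑ᶠ p : ℤ × ℕ,
      Ring.choose p.1 p.2 • (P.coeff p.1 * D^[p.2] (Q.coeff (n - p.1 + p.2))), by
    obtain ⟨N, hN⟩ := P.bounded
    obtain ⟨M, hM⟩ := Q.bounded
    refine ⟨N + M, fun n hn => finsum_eq_zero_of_forall_eq_zero fun p => ?_⟩
    by_contra hp
    have := mul_support P Q hN hM n p hp
    omega⟩⟩

theorem coeff_mul (P Q : PseudoDiffOp D) (n : ℤ) : (P * Q).coeff n = ∑ᶠ p : ℤ × ℕ,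
    Ring.choose p.1 p.2 • (P.coeff p.1 * D^[p.2] (Q.coeff (n - p.1 + p.2))) := rfl

theorem coeff_zero (n : ℤ) : (0 : PseudoDiffOp D).coeff n = 0 := rfl

theorem coeff_add (P Q : PseudoDiffOp D) (n : ℤ) :
    (P + Q).coeff n = P.coeff n + Q.coeff n := rfl

theorem coeff_neg (P : PseudoDiffOp D) (n : ℤ) : (-P).coeff n = -P.coeff n := rfl

theorem coeff_one (n : ℤ) : (1 : PseudoDiffOp D).coeff n = if n = 0 then 1 else 0 := rfl

theorem coeff_monomial (a : A) (m n : ℤ) :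
    (monomial D a n).coeff m = if m = n then a else 0 := rfl

theorem coeff_mul_of_lt (P Q : PseudoDiffOp D) {N M : ℤ} (hN : ∀ n, N < n → P.coeff n = 0)
    (hM : ∀ n, M < n → Q.coeff n = 0) (n : ℤ) (hn : N + M < n) : (P * Q).coeff n = 0 := by
  rw [coeff_mul]
  refine finsum_eq_zero_of_forall_eq_zero fun p => ?_
  by_contra hp
  have := mul_support P Q hN hM n p hp
  omega

/-- The product in terms of the depth below the leading order. -/
theorem coeff_mul_depth (P Q : PseudoDiffOp D) {N M : ℤ} (hN : ∀ n, N < n → P.coeff n = 0)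
    (hM : ∀ n, M < n → Q.coeff n = 0) (d : ℕ) : (P * Q).coeff (N + M - d) =
      ∑ x ∈ Finset.HasAntidiagonal.antidiagonal d, ∑ y ∈ Finset.HasAntidiagonal.antidiagonal x.2,
        Ring.choose (N - x.1) y.2 • (P.coeff (N - x.1) * D^[y.2] (Q.coeff (M - y.1))) := by
  rw [coeff_mul, Finset.sum_sigma']
  set S := (Finset.HasAntidiagonal.antidiagonal d).sigma fun x : ℕ × ℕ => Finset.HasAntidiagonal.antidiagonal x.2 with hS
  have hinj : Set.InjOn (fun z : (Σ _ : ℕ × ℕ, ℕ × ℕ) => ((N - z.1.1, z.2.2) : ℤ × ℕ)) S := by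
    rintro ⟨⟨a, b⟩, c, e⟩ h ⟨⟨a', b'⟩, c', e'⟩ h' heq
    simp only [hS, Finset.coe_sigma, Set.mem_sigma_iff, Finset.mem_coe,
      Finset.HasAntidiagonal.mem_antidiagonal, Prod.mk.injEq] at h h' heq
    have h1 : a = a' := by omega
    have h2 : b = b' := by omega
    have h3 : e = e' := by omega
    have h4 : c = c' := by omega
    subst h1 h2 h3 h4
    rfl
  rw [finsum_eq_sum_of_support_subset (s := S.image fun z => ((N - z.1.1, z.2.2) : ℤ × ℕ)),
    Finset.sum_image hinj]
  · refine Finset.sum_congr rfl ?_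
    rintro ⟨⟨a, b⟩, c, e⟩ h
    simp only [hS, Finset.mem_sigma, Finset.HasAntidiagonal.mem_antidiagonal] at h
    have : N + M - (d : ℤ) - (N - a) + e = M - c := by omega
    simp only [this]
  · rintro ⟨i, r⟩ hp
    have h := mul_support P Q hN hM _ _ hp
    simp only at h
    simp only [Finset.coe_image, Set.mem_image, hS, Finset.mem_coe, Finset.mem_sigma,
      Finset.HasAntidiagonal.mem_antidiagonal]
    refine ⟨⟨((N - i).toNat, d - (N - i).toNat), (d - (N - i).toNat - r, r)⟩, ?_, ?_⟩
    · constructor <;> simp only <;> omega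
    · simp only [Prod.mk.injEq, and_true]; omega

theorem iterate_mul (D : Derivation k A A) (n : ℕ) (a b : A) : D^[n] (a * b) =
    ∑ z ∈ Finset.HasAntidiagonal.antidiagonal n, (n.choose z.1 : ℤ) • (D^[z.1] a * D^[z.2] b) := by
  induction n with
  | zero => simp
  | succ n ih =>
    have key := Finset.sum_antidiagonal_choose_succ_nsmul (fun i j => D^[i] a * D^[j] b) n
    simp only [natCast_zsmul]
    rw [key, Function.iterate_succ_apply', ih]
    simp only [natCast_zsmul, map_sum, map_nsmul, Derivation.leibniz, smul_eq_mul, smul_add,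
      Finset.sum_add_distrib, Function.iterate_succ_apply']
    congr 1
    refine Finset.sum_congr rfl fun z hz => ?_
    rw [Nat.choose_symm_of_eq_add (Finset.HasAntidiagonal.mem_antidiagonal.mp hz).symm, mul_comm]

theorem choose_mul_choose (x : ℤ) (r b : ℕ) :
    Ring.choose x (r + b) * ((r + b).choose r : ℤ) = Ring.choose x r * Ring.choose (x - r) b := by
  have h := Ring.choose_add_smul_choose (x - r) b r
  rw [sub_add_cancel, nsmul_eq_mul, add_comm b r] at h
  rw [← h, mul_comm]

theorem iterate_zsmul (D : Derivation k A A) (n : ℕ) (c : ℤ) (a : A) :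
    D^[n] (c • a) = c • D^[n] a := by
  induction n with
  | zero => rfl
  | succ n ih => rw [Function.iterate_succ_apply', ih, map_zsmul, Function.iterate_succ_apply']

theorem iterate_sum {ι : Type*} (D : Derivation k A A) (n : ℕ) (s : Finset ι) (f : ι → A) :
    D^[n] (∑ i ∈ s, f i) = ∑ i ∈ s, D^[n] (f i) := by
  induction n with
  | zero => rfl
  | succ n ih => simp only [Function.iterate_succ_apply', ih, map_sum]

theorem assoc_aux (D : Derivation k A A) (p q r : ℕ → A) (N M : ℤ) (d : ℕ) :
    ∑ x ∈ Finset.HasAntidiagonal.antidiagonal d, ∑ y ∈ Finset.HasAntidiagonal.antidiagonal x.2,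
      Ring.choose (N + M - x.1) y.2 • ((∑ z ∈ Finset.HasAntidiagonal.antidiagonal x.1,
        ∑ w ∈ Finset.HasAntidiagonal.antidiagonal z.2,
          Ring.choose (N - z.1) w.2 • (p z.1 * D^[w.2] (q w.1))) * D^[y.2] (r y.1)) =
    ∑ x ∈ Finset.HasAntidiagonal.antidiagonal d, ∑ y ∈ Finset.HasAntidiagonal.antidiagonal x.2,
      Ring.choose (N - x.1) y.2 • (p x.1 * D^[y.2] (∑ z ∈ Finset.HasAntidiagonal.antidiagonal y.1,
        ∑ w ∈ Finset.HasAntidiagonal.antidiagonal z.2,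
          Ring.choose (M - z.1) w.2 • (q z.1 * D^[w.2] (r w.1)))) := by
  have hL : ∀ x ∈ Finset.HasAntidiagonal.antidiagonal d, ∀ y ∈ Finset.HasAntidiagonal.antidiagonal x.2,
      Ring.choose (N + M - x.1) y.2 • ((∑ z ∈ Finset.HasAntidiagonal.antidiagonal x.1,
        ∑ w ∈ Finset.HasAntidiagonal.antidiagonal z.2,
          Ring.choose (N - z.1) w.2 • (p z.1 * D^[w.2] (q w.1))) * D^[y.2] (r y.1)) =
      ∑ z ∈ Finset.HasAntidiagonal.antidiagonal x.1, ∑ w ∈ Finset.HasAntidiagonal.antidiagonal z.2,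
        ∑ v ∈ Finset.HasAntidiagonal.antidiagonal y.2,
          (Ring.choose (N - z.1) w.2 * Ring.choose (N - z.1 - w.2) v.1 *
            Ring.choose (M - w.1) v.2) •
            (p z.1 * D^[w.2] (q w.1) * D^[v.1 + v.2] (r y.1)) := by
    intro x _ y _
    rw [Finset.sum_mul, Finset.smul_sum]
    refine Finset.sum_congr rfl fun z hz => ?_
    rw [Finset.sum_mul, Finset.smul_sum]
    refine Finset.sum_congr rfl fun w hw => ?_
    rw [Finset.HasAntidiagonal.mem_antidiagonal] at hz hw
    have e : N + M - (x.1 : ℤ) = (N - z.1 - w.2) + (M - w.1) := by omega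
    rw [e, Ring.add_choose_eq _ (Commute.all _ _), Finset.sum_smul]
    refine Finset.sum_congr rfl fun v hv => ?_
    rw [Finset.HasAntidiagonal.mem_antidiagonal] at hv
    rw [hv, smul_mul_assoc, smul_smul]
    congr 1
    ring
  have hR : ∀ x ∈ Finset.HasAntidiagonal.antidiagonal d, ∀ y ∈ Finset.HasAntidiagonal.antidiagonal x.2,
      Ring.choose (N - x.1) y.2 • (p x.1 * D^[y.2] (∑ z ∈ Finset.HasAntidiagonal.antidiagonal y.1,
        ∑ w ∈ Finset.HasAntidiagonal.antidiagonal z.2,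
          Ring.choose (M - z.1) w.2 • (q z.1 * D^[w.2] (r w.1)))) =
      ∑ z ∈ Finset.HasAntidiagonal.antidiagonal y.1, ∑ w ∈ Finset.HasAntidiagonal.antidiagonal z.2,
        ∑ v ∈ Finset.HasAntidiagonal.antidiagonal y.2,
          (Ring.choose (N - x.1) v.1 * Ring.choose (N - x.1 - v.1) v.2 *
            Ring.choose (M - z.1) w.2) •
            (p x.1 * D^[v.1] (q z.1) * D^[v.2 + w.2] (r w.1)) := by
    intro x _ y _
    rw [iterate_sum, Finset.mul_sum, Finset.smul_sum]
    refine Finset.sum_congr rfl fun z _ => ?_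
    rw [iterate_sum, Finset.mul_sum, Finset.smul_sum]
    refine Finset.sum_congr rfl fun w _ => ?_
    rw [iterate_zsmul, iterate_mul, Finset.smul_sum, Finset.mul_sum, Finset.smul_sum]
    refine Finset.sum_congr rfl fun v hv => ?_
    rw [Finset.HasAntidiagonal.mem_antidiagonal] at hv
    rw [← choose_mul_choose, hv, Function.iterate_add_apply, mul_smul_comm, mul_smul_comm,
      smul_smul, smul_smul, mul_assoc (p x.1)]
    congr 1
    ring
  rw [Finset.sum_congr rfl fun x hx => Finset.sum_congr rfl (hL x hx),
    Finset.sum_congr rfl fun x hx => Finset.sum_congr rfl (hR x hx)]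
  simp only [Finset.sum_sigma']
  refine Finset.sum_bij'
    (fun t _ => ⟨(t.2.2.1.1, d - t.2.2.1.1),
      ⟨(d - t.2.2.1.1 - (t.2.2.2.1.2 + t.2.2.2.2.1), t.2.2.2.1.2 + t.2.2.2.2.1),
      ⟨(t.2.2.2.1.1, t.2.1.1 + t.2.2.2.2.2),
      ⟨(t.2.1.1, t.2.2.2.2.2), (t.2.2.2.1.2, t.2.2.2.2.1)⟩⟩⟩⟩)
    (fun t _ => ⟨(t.1.1 + t.2.2.1.1 + t.2.2.2.2.1,
      t.2.2.2.1.1 + (t.2.2.2.2.2 + t.2.2.2.1.2)),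
      ⟨(t.2.2.2.1.1, t.2.2.2.2.2 + t.2.2.2.1.2),
      ⟨(t.1.1, t.2.2.1.1 + t.2.2.2.2.1),
      ⟨(t.2.2.1.1, t.2.2.2.2.1), (t.2.2.2.2.2, t.2.2.2.1.2)⟩⟩⟩⟩)
    ?_ ?_ ?_ ?_ ?_
  · rintro ⟨⟨a, b⟩, ⟨c, e⟩, ⟨f, g⟩, ⟨h, i⟩, j, l⟩ ht
    simp only [Finset.mem_sigma, Finset.HasAntidiagonal.mem_antidiagonal, and_true] at ht ⊢
    omega
  · rintro ⟨⟨a, b⟩, ⟨c, e⟩, ⟨f, g⟩, ⟨h, i⟩, j, l⟩ ht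
    simp only [Finset.mem_sigma, Finset.HasAntidiagonal.mem_antidiagonal, and_true, true_and] at ht ⊢
    omega
  · rintro ⟨⟨a, b⟩, ⟨c, e⟩, ⟨f, g⟩, ⟨h, i⟩, j, l⟩ ht
    simp only [Finset.mem_sigma, Finset.HasAntidiagonal.mem_antidiagonal] at ht
    simp only [Sigma.mk.injEq, Prod.mk.injEq, heq_eq_eq, and_true, true_and]
    omega
  · rintro ⟨⟨a, b⟩, ⟨c, e⟩, ⟨f, g⟩, ⟨h, i⟩, j, l⟩ ht
    simp only [Finset.mem_sigma, Finset.HasAntidiagonal.mem_antidiagonal] at ht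
    simp only [Sigma.mk.injEq, Prod.mk.injEq, heq_eq_eq, and_true, true_and]
    omega
  · rintro ⟨⟨a, b⟩, ⟨c, e⟩, ⟨f, g⟩, ⟨h, i⟩, j, l⟩ ht
    rfl

theorem coeff_eq_of_bounded {P Q : PseudoDiffOp D} {N : ℤ} (hP : ∀ n, N < n → P.coeff n = 0)
    (hQ : ∀ n, N < n → Q.coeff n = 0) (h : ∀ d : ℕ, P.coeff (N - d) = Q.coeff (N - d)) :
    P = Q := by
  refine ext_coeff fun n => ?_
  by_cases hn : N < n
  · rw [hP n hn, hQ n hn]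
  · have : n = N - ((N - n).toNat : ℕ) := by omega
    rw [this, h]

theorem mul_assoc_op (P Q R : PseudoDiffOp D) : P * Q * R = P * (Q * R) := by
  obtain ⟨N, hN⟩ := P.bounded
  obtain ⟨M, hM⟩ := Q.bounded
  obtain ⟨K, hK⟩ := R.bounded
  have hPQ := coeff_mul_of_lt P Q hN hM
  have hQR := coeff_mul_of_lt Q R hM hK
  refine coeff_eq_of_bounded (coeff_mul_of_lt _ _ hPQ hK)
    (fun n hn => coeff_mul_of_lt _ _ hN hQR n (by omega)) fun d => ?_
  rw [coeff_mul_depth _ _ hPQ hK, add_assoc N M K, coeff_mul_depth _ _ hN hQR]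
  simp only [coeff_mul_depth _ _ hN hM, coeff_mul_depth _ _ hM hK]
  exact assoc_aux D (fun i => P.coeff (N - i)) (fun i => Q.coeff (M - i))
    (fun i => R.coeff (K - i)) N M d

theorem exists_bound₂ (P Q : PseudoDiffOp D) :
    ∃ N : ℤ, (∀ n, N < n → P.coeff n = 0) ∧ ∀ n, N < n → Q.coeff n = 0 := by
  obtain ⟨N, hN⟩ := P.bounded
  obtain ⟨M, hM⟩ := Q.bounded
  exact ⟨max N M, fun n hn => hN n (lt_of_le_of_lt (le_max_left _ _) hn),
    fun n hn => hM n (lt_of_le_of_lt (le_max_right _ _) hn)⟩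

theorem coeff_add_of_lt {P Q : PseudoDiffOp D} {N : ℤ} (hP : ∀ n, N < n → P.coeff n = 0)
    (hQ : ∀ n, N < n → Q.coeff n = 0) (n : ℤ) (hn : N < n) : (P + Q).coeff n = 0 := by
  rw [coeff_add, hP n hn, hQ n hn, add_zero]

theorem iterate_add (D : Derivation k A A) (n : ℕ) (a b : A) :
    D^[n] (a + b) = D^[n] a + D^[n] b := by
  induction n with
  | zero => rfl
  | succ n ih => simp only [Function.iterate_succ_apply', ih, map_add]

theorem left_distrib_op (P Q R : PseudoDiffOp D) : P * (Q + R) = P * Q + P * R := by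
  obtain ⟨N, hN⟩ := P.bounded
  obtain ⟨M, hQ, hR⟩ := exists_bound₂ Q R
  have hQR := coeff_add_of_lt hQ hR
  refine coeff_eq_of_bounded (coeff_mul_of_lt _ _ hN hQR)
    (coeff_add_of_lt (coeff_mul_of_lt _ _ hN hQ) (coeff_mul_of_lt _ _ hN hR)) fun d => ?_
  rw [coeff_add, coeff_mul_depth _ _ hN hQR, coeff_mul_depth _ _ hN hQ, coeff_mul_depth _ _ hN hR]
  simp only [coeff_add, iterate_add, mul_add, smul_add, Finset.sum_add_distrib]

theorem right_distrib_op (P Q R : PseudoDiffOp D) : (P + Q) * R = P * R + Q * R := by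
  obtain ⟨M, hM⟩ := R.bounded
  obtain ⟨N, hP, hQ⟩ := exists_bound₂ P Q
  have hPQ := coeff_add_of_lt hP hQ
  refine coeff_eq_of_bounded (coeff_mul_of_lt _ _ hPQ hM)
    (coeff_add_of_lt (coeff_mul_of_lt _ _ hP hM) (coeff_mul_of_lt _ _ hQ hM)) fun d => ?_
  rw [coeff_add, coeff_mul_depth _ _ hPQ hM, coeff_mul_depth _ _ hP hM, coeff_mul_depth _ _ hQ hM]
  simp only [coeff_add, add_mul, smul_add, Finset.sum_add_distrib]

theorem iterate_one (D : Derivation k A A) {r : ℕ} (hr : r ≠ 0) : D^[r] (1 : A) = 0 := by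
  obtain ⟨r, rfl⟩ := Nat.exists_eq_succ_of_ne_zero hr
  rw [Function.iterate_succ_apply, Derivation.map_one_eq_zero, iterate_map_zero]

theorem one_mul_op (P : PseudoDiffOp D) : 1 * P = P := by
  refine ext_coeff fun n => ?_
  rw [coeff_mul, finsum_eq_single _ ((0, 0) : ℤ × ℕ)]
  · simp [coeff_one]
  · rintro ⟨i, r⟩ h
    by_cases hi : i = 0
    · subst hi
      have hr : r ≠ 0 := by rintro rfl; exact h rfl
      obtain ⟨r, rfl⟩ := Nat.exists_eq_succ_of_ne_zero hr
      simp only [Nat.succ_eq_add_one, Ring.choose_zero_succ, zero_smul]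
    · simp [coeff_one, hi]

theorem mul_one_op (P : PseudoDiffOp D) : P * 1 = P := by
  refine ext_coeff fun n => ?_
  rw [coeff_mul, finsum_eq_single _ ((n, 0) : ℤ × ℕ)]
  · simp [coeff_one]
  · rintro ⟨i, r⟩ h
    by_cases hr : r = 0
    · subst hr
      have hi : n - i ≠ 0 := fun h0 => h (by rw [sub_eq_zero.mp h0])
      simp [coeff_one, hi]
    · simp only [coeff_one]
      split_ifs
      · rw [iterate_one D hr, mul_zero, smul_zero]
      · rw [iterate_map_zero, mul_zero, smul_zero]

/-- The (noncommutative) ring of formal pseudo-differential operators. -/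
instance : Ring (PseudoDiffOp D) where
  add_assoc P Q R := ext_coeff fun n => add_assoc _ _ _
  zero_add P := ext_coeff fun n => zero_add _
  add_zero P := ext_coeff fun n => add_zero _
  add_comm P Q := ext_coeff fun n => add_comm _ _
  neg_add_cancel P := ext_coeff fun n => neg_add_cancel _
  mul_assoc := mul_assoc_op
  left_distrib := left_distrib_op
  right_distrib := right_distrib_op
  one_mul := one_mul_op
  mul_one := mul_one_op
  zero_mul P := ext_coeff fun n => by simp [coeff_mul, coeff_zero]
  mul_zero P := ext_coeff fun n => by simp [coeff_mul, coeff_zero]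
  nsmul := nsmulRec
  zsmul := zsmulRec

/-- The projection `(·)_{≥0}` onto differential operators. -/
def nonnegPart (P : PseudoDiffOp D) : PseudoDiffOp D :=
  ⟨fun n => if 0 ≤ n then P.coeff n else 0, by
    obtain ⟨N, hN⟩ := P.bounded
    exact ⟨N, fun n hn => by rw [hN n hn, ite_self]⟩⟩

/-- `P′ = ∑ D(a_n) ∂ⁿ` for `P = ∑ a_n ∂ⁿ`. -/
def coeffDeriv (P : PseudoDiffOp D) : PseudoDiffOp D :=
  ⟨fun n => D (P.coeff n), by
    obtain ⟨N, hN⟩ := P.bounded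
    exact ⟨N, fun n hn => by rw [hN n hn, map_zero]⟩⟩

/-- The operator `∑_{n ≥ 0} v_n ∂⁻ⁿ` with symbol `∑_{n ≥ 0} v_n λ⁻ⁿ`. -/
def ofSymbol (D : Derivation k A A) (v : ℕ → A) : PseudoDiffOp D :=
  ⟨fun n => if n ≤ 0 then v (-n).toNat else 0, 0, fun _ hn => if_neg (not_le.mpr hn)⟩

/-- `P` has the form `∂ + ∑_{j ≥ 1} u_{j+1} ∂⁻ʲ`. -/
def IsLaxOperator (P : PseudoDiffOp D) : Prop :=
  (∀ n : ℤ, 1 < n → P.coeff n = 0) ∧ P.coeff 1 = 1 ∧ P.coeff 0 = 0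

/-- `P` is a stationary (time-independent) solution of the KP hierarchy
`∂P/∂t_m = [(P^m)_{≥0}, P]`, `m = 2, 3, …`. -/
def IsStationaryKP (P : PseudoDiffOp D) : Prop :=
  P.IsLaxOperator ∧ ∀ n : ℕ, ⁅(P ^ (n + 2)).nonnegPart, P⁆ = 0

end PseudoDiffOp

/-! ## Weierstrass functions and holomorphic coefficients -/

namespace PeriodPair

variable (L : PeriodPair)

/-- The Weierstrass zeta function `1/z + ∑_{l ≠ 0} (1/(z - l) + 1/l + z/l²)`; since `1/0 = 0`,
the term `l = 0` of the sum below is `1/z`. -/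
def weierstrassZeta (z : ℂ) : ℂ :=
  ∑' l : L.lattice, (1 / (z - l) + 1 / (l : ℂ) + z / (l : ℂ) ^ 2)

/-- The Weierstrass sigma function `z ∏_{l ≠ 0} (1 - z/l) exp(z/l + z²/(2l²))`; since `z/0 = 0`,
the factor `l = 0` of the product below is `1`. -/
def weierstrassSigma (z : ℂ) : ℂ :=
  z * ∏' l : L.lattice,
    (1 - z / (l : ℂ)) * Complex.exp (z / (l : ℂ) + z ^ 2 / (2 * (l : ℂ) ^ 2))

/-- The coefficient `a_n` of the Laurent expansion `℘(z) = 1/z² + ∑_{n ≥ 0} a_n zⁿ` at `0`.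
Here `L.weierstrassPExcept 0` is the function `℘(z) - 1/z²`, which is analytic at `0`. -/
def laurentCoeff (n : ℕ) : ℂ := iteratedDeriv n (L.weierstrassPExcept 0) 0 / (n.factorial : ℂ)

/-- Extension by zero of a function on the complement of the lattice. -/
def extendZero (f : ((L.lattice : Set ℂ)ᶜ : Set ℂ) → ℂ) : ℂ → ℂ :=
  Function.extend Subtype.val f 0

variable {L} in
theorem extendZero_apply (f : ((L.lattice : Set ℂ)ᶜ : Set ℂ) → ℂ)
    (z : ((L.lattice : Set ℂ)ᶜ : Set ℂ)) : L.extendZero f z = f z :=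
  Subtype.val_injective.extend_apply f 0 z

theorem extendZero_eqOn {f : ((L.lattice : Set ℂ)ᶜ : Set ℂ) → ℂ} {F : ℂ → ℂ}
    (h : ∀ z : ((L.lattice : Set ℂ)ᶜ : Set ℂ), f z = F z) :
    Set.EqOn (L.extendZero f) F ((L.lattice : Set ℂ)ᶜ) := fun z hz =>
  (extendZero_apply f ⟨z, hz⟩).trans (h ⟨z, hz⟩)

theorem differentiableOn_extendZero {f : ((L.lattice : Set ℂ)ᶜ : Set ℂ) → ℂ} {F : ℂ → ℂ}
    (h : ∀ z : ((L.lattice : Set ℂ)ᶜ : Set ℂ), f z = F z)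
    (hF : DifferentiableOn ℂ F ((L.lattice : Set ℂ)ᶜ)) :
    DifferentiableOn ℂ (L.extendZero f) ((L.lattice : Set ℂ)ᶜ) :=
  hF.congr (L.extendZero_eqOn h)

/-- The algebra of holomorphic functions on the complement of the lattice. -/
def holomorphicFun : Subalgebra ℂ (((L.lattice : Set ℂ)ᶜ : Set ℂ) → ℂ) where
  carrier := {f | DifferentiableOn ℂ (L.extendZero f) ((L.lattice : Set ℂ)ᶜ)}
  mul_mem' {f g} hf hg := L.differentiableOn_extendZero
    (F := fun z => L.extendZero f z * L.extendZero g z)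
    (fun z => by rw [extendZero_apply, extendZero_apply, Pi.mul_apply]) (hf.fun_mul hg)
  add_mem' {f g} hf hg := L.differentiableOn_extendZero
    (F := fun z => L.extendZero f z + L.extendZero g z)
    (fun z => by rw [extendZero_apply, extendZero_apply, Pi.add_apply]) (hf.fun_add hg)
  algebraMap_mem' c := L.differentiableOn_extendZero (F := fun _ => c) (fun _ => rfl)
    (differentiableOn_const c)

/-- The restriction to the complement of the lattice of a function holomorphic there. -/
def toHolomorphicFun (F : ℂ → ℂ) (hF : DifferentiableOn ℂ F ((L.lattice : Set ℂ)ᶜ)) :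
    L.holomorphicFun :=
  ⟨fun z => F z, L.differentiableOn_extendZero (fun _ => rfl) hF⟩

theorem hasDerivAt_extendZero (f : L.holomorphicFun) (z : ((L.lattice : Set ℂ)ᶜ : Set ℂ)) :
    HasDerivAt (L.extendZero f.1) (deriv (L.extendZero f.1) z) z :=
  (f.2.differentiableAt (L.isClosed_lattice.isOpen_compl.mem_nhds z.2)).hasDerivAt

theorem deriv_extendZero {f : ((L.lattice : Set ℂ)ᶜ : Set ℂ) → ℂ} {F : ℂ → ℂ}
    (h : ∀ z : ((L.lattice : Set ℂ)ᶜ : Set ℂ), f z = F z)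
    (z : ((L.lattice : Set ℂ)ᶜ : Set ℂ)) : deriv (L.extendZero f) z = deriv F z :=
  ((L.extendZero_eqOn h).eventuallyEq_of_mem
    (L.isClosed_lattice.isOpen_compl.mem_nhds z.2)).deriv_eq

/-- The derivation `d/dx` of the algebra of holomorphic functions. -/
def derivation : Derivation ℂ L.holomorphicFun L.holomorphicFun :=
  Derivation.mk'
    { toFun := fun f => L.toHolomorphicFun (deriv (L.extendZero f.1))
        (DifferentiableOn.deriv f.2 L.isClosed_lattice.isOpen_compl)
      map_add' := fun f g => Subtype.ext <| funext fun z =>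
        (L.deriv_extendZero (F := fun w => L.extendZero f.1 w + L.extendZero g.1 w)
          (fun w => by rw [extendZero_apply, extendZero_apply]; rfl) z).trans
          ((L.hasDerivAt_extendZero f z).fun_add (L.hasDerivAt_extendZero g z)).deriv
      map_smul' := fun c f => Subtype.ext <| funext fun z =>
        (L.deriv_extendZero (F := fun w => c * L.extendZero f.1 w)
          (fun w => by rw [extendZero_apply]; rfl) z).trans
          ((L.hasDerivAt_extendZero f z).const_mul c).deriv }
    (fun f g => Subtype.ext <| funext fun z => by
      refine (L.deriv_extendZero (F := fun w => L.extendZero f.1 w * L.extendZero g.1 w)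
          (fun w => by rw [extendZero_apply, extendZero_apply]; rfl) z).trans
          (((L.hasDerivAt_extendZero f z).fun_mul (L.hasDerivAt_extendZero g z)).deriv.trans ?_)
      rw [extendZero_apply, extendZero_apply, add_comm, mul_comm (deriv _ _)]
      rfl)

/-- Pseudo-differential operators in `x` with coefficients holomorphic off the lattice. -/
abbrev PDO := PseudoDiffOp L.derivation

/-- A complex constant as an operator. -/
def constOp (c : ℂ) : L.PDO := PseudoDiffOp.mulBy L.derivation (algebraMap ℂ L.holomorphicFun c)

/-- The function `σ(x - λ⁻¹) / σ(x) · exp((ζ(λ⁻¹) - λ) x)`. -/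
def vHat (x lam : ℂ) : ℂ :=
  L.weierstrassSigma (x - lam⁻¹) / L.weierstrassSigma x *
    Complex.exp ((L.weierstrassZeta lam⁻¹ - lam) * x)

/-- The sequence `v` of functions of `x` is the coefficient sequence of the expansion
`vHat(x, λ) = ∑_{n ≥ 0} v_n(x) λ⁻ⁿ` around `λ = ∞`. -/
def IsExpansionOfVHat (v : ℕ → L.holomorphicFun) : Prop :=
  ∀ x : ((L.lattice : Set ℂ)ᶜ : Set ℂ), ∀ᶠ lam in Bornology.cobounded ℂ,
    HasSum (fun n : ℕ => (v n).1 x * (lam⁻¹) ^ n) (L.vHat x lam)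

/-- The operator `U_{n+2} = ∂^{n+2} + a_n/(n+1) + ∑_{m ≥ 1} (-1)^m (m+n)!/(m! (n+1)!) a_{m+n} ∂^{-m}`;
it has constant coefficients, and the term `a_n/(n+1)` is the one for `m = 0`. -/
def opU (n : ℕ) : L.PDO :=
  PseudoDiffOp.del L.derivation ^ (n + 2) +
    PseudoDiffOp.ofSymbol L.derivation fun m => algebraMap ℂ L.holomorphicFun
      ((-1) ^ m * ((m + n).factorial : ℂ) / ((m.factorial : ℂ) * ((n + 1).factorial : ℂ)) *
        L.laurentCoeff (m + n))

/-- The function `℘` as a coefficient. -/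
def wp : L.holomorphicFun := L.toHolomorphicFun L.weierstrassP L.differentiableOn_weierstrassP

/-- The pair `(P_{n+2}, Q_{n+1})`, where `P_2 = ∂² - 2℘`, `Q_1 = ℘ ∂ - ℘′/2`,
`P_{n+1} = P_n ∂ + P_n′ - Q_{n-1}` and `Q_n = 2℘ P_n - Q_{n-1} ∂ - Q_{n-1}′`. -/
def lamePQ : ℕ → L.PDO × L.PDO
  | 0 => (PseudoDiffOp.del L.derivation ^ 2 - PseudoDiffOp.mulBy L.derivation (2 * L.wp),
      PseudoDiffOp.mulBy L.derivation L.wp * PseudoDiffOp.del L.derivation -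
        PseudoDiffOp.mulBy L.derivation ((1 / 2 : ℂ) • L.derivation L.wp))
  | n + 1 =>
      ((lamePQ n).1 * PseudoDiffOp.del L.derivation + (lamePQ n).1.coeffDeriv - (lamePQ n).2,
        PseudoDiffOp.mulBy L.derivation (2 * L.wp) * (lamePQ n).1 -
          (lamePQ n).2 * PseudoDiffOp.del L.derivation - (lamePQ n).2.coeffDeriv)

/-- The operator `P_n`, for `n ≥ 2`. -/
def lameP (n : ℕ) : L.PDO := (L.lamePQ (n - 2)).1

/-- The polynomials `R_n` with `R_0 = X` and
`R_{n+1} = (6X² - g₂/2) R_n′ + (4X³ - g₂X - g₃) R_n″`, for which `℘^{(2n)} = R_n(℘)`. -/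
def polyR : ℕ → Polynomial ℂ
  | 0 => Polynomial.X
  | n + 1 =>
      (6 * Polynomial.X ^ 2 - Polynomial.C (L.g₂ / 2)) * Polynomial.derivative (polyR n) +
      (4 * Polynomial.X ^ 3 - Polynomial.C L.g₂ * Polynomial.X - Polynomial.C L.g₃) *
        Polynomial.derivative (Polynomial.derivative (polyR n))

/-- The numbers `r_{n,j}` with `R_n = (2n+1)! (X^{n+1} + ∑_{j=0}^{n-1} r_{n,j} X^j)`. -/
def coeffR (n j : ℕ) : ℂ := (L.polyR n).coeff j / ((2 * n + 1).factorial : ℂ)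

/-- The differential operators `P̃_n`, for `n ≥ 2`:
`P̃_{2m+2} = P_{2m+2} + ∑_{j=1}^{m-1} r_{m,j} P_{2j} + r_{m,0}` and
`P̃_{2m+3} = P_{2m+3} + ∑_{j=1}^{m-1} (j r_{m,j}/(m+1)) P_{2j+1}`. -/
def tildeP (n : ℕ) : L.PDO :=
  let m := n / 2 - 1
  if Even n then
    L.lameP n + ∑ j ∈ Finset.Ico 1 m, L.constOp (L.coeffR m j) * L.lameP (2 * j) +
      L.constOp (L.coeffR m 0)
  else
    L.lameP n + ∑ j ∈ Finset.Ico 1 m,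
      L.constOp ((j : ℂ) * L.coeffR m j / ((m : ℂ) + 1)) * L.lameP (2 * j + 1)

end PeriodPair

end

/-!
A pseudo-differential operator is determined by its symbol, a Laurent series in `X = ∂⁻¹`. On
symbols, `∂` acts from the left as `D + X⁻¹`, with `D` the coefficientwise derivative, and operators
with constant coefficients multiply from the right by multiplication of symbols.

Let `p = ℘(x)`, `w = ℘(X)`, `w' = dw/dX` and `Z = ζ(x - X) - ζ(x) + ζ(X)`. The symbol `V` of `V₀` is
the expansion of `vHat` in `X = λ⁻¹`; it is the solution with constant term `1` of a linear
differential equation in `X`, and `D V = (Z - X⁻¹) V`. Thus `∂` sends the symbol `s V` to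
`(D s + Z s) V`. The addition theorem `2 (p - w) Z = p' + w'` yields the Riccati equation
`D Z + Z² = 2 p + w`, and with these two identities the recursion for `P_n` and `Q_n` becomes
explicit: `P_{2j}` multiplies `V` by `wʲ`, and `P_{2j+1}` multiplies it by `-wʲ⁻¹ w' / 2`. Since
the derivatives of `w` are `w^{(2m)} = R_m(w)` and `w^{(2m+1)} = R_m'(w) w'`, the combination
`P̃_{n+2}` multiplies `V` by `(-1)ⁿ w^{(n)} / (n+1)!`, which is the symbol of `U_{n+2}`. Therefore
`P̃_{n+2} V₀ = V₀ U_{n+2}`.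

Conjugating `U_{n+2} = ∂^{n+2} + a_n / (n+1) + O(∂⁻¹)` by `V₀` then identifies `P̃_{n+2}` with
`L₀^{n+2} + a_n / (n+1) + O(∂⁻¹)`. Since `P̃_{n+2}` is a differential operator, it is
`(L₀^{n+2})_{≥ 0} + a_n / (n+1)`; and it commutes with `L₀` because `U_{n+2}` commutes with `∂`.
-/

noncomputable section

open Finset.HasAntidiagonal (antidiagonal mem_antidiagonal)

theorem exists_forall_eq_of_lt {B : Type*} [Nonempty B] (Φ : ℕ → (ℕ → B) → B)
    (hΦ : ∀ n s t, (∀ i < n, s i = t i) → Φ n s = Φ n t) : ∃ t : ℕ → B, ∀ n, t n = Φ n t := by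
  classical
  obtain ⟨b⟩ := ‹Nonempty B›
  let T : ℕ → B := fun n =>
    Nat.strongRec (fun n t => Φ n fun i => if hi : i < n then t i hi else b) n
  refine ⟨T, fun n => ?_⟩
  have hT : T n = Φ n fun i => if i < n then T i else b := by
    simp only [T]
    rw [Nat.strongRec_eq]
    rfl
  rw [hT]
  exact hΦ n _ _ fun i hi => if_pos hi

namespace PseudoDiffOp

section Ring

variable {k A : Type*} [CommRing k] [CommRing A] [Algebra k A] {D : Derivation k A A}
  {P Q : PseudoDiffOp D}

theorem coeff_sub (P Q : PseudoDiffOp D) (n : ℤ) :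
    (P - Q).coeff n = P.coeff n - Q.coeff n := by
  rw [sub_eq_add_neg, coeff_add, coeff_neg, sub_eq_add_neg]

theorem coeff_del (n : ℤ) : (del D).coeff n = if n = 1 then 1 else 0 := rfl

theorem coeff_mulBy (a : A) (n : ℤ) : (mulBy D a).coeff n = if n = 0 then a else 0 := rfl

theorem coeff_mulBy_mul (a : A) (P : PseudoDiffOp D) (n : ℤ) :
    (mulBy D a * P).coeff n = a * P.coeff n := by
  rw [coeff_mul, finsum_eq_single _ ((0, 0) : ℤ × ℕ)]
  · simp [coeff_mulBy]
  · rintro ⟨i, r⟩ h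
    obtain rfl | hi := eq_or_ne i 0
    · obtain ⟨r, rfl⟩ := Nat.exists_eq_succ_of_ne_zero (n := r) (by rintro rfl; exact h rfl)
      simp [Ring.choose_zero_succ]
    · simp [coeff_mulBy, hi]

theorem coeff_mul_monomial (P : PseudoDiffOp D) {c : A} (hc : D c = 0) (j n : ℤ) :
    (P * monomial D c j).coeff n = P.coeff (n - j) * c := by
  rw [coeff_mul, finsum_eq_single _ ((n - j, 0) : ℤ × ℕ)]
  · simp [coeff_monomial]
  · rintro ⟨i, r⟩ h
    obtain rfl | hr := r.eq_zero_or_pos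
    · have hi : n - i ≠ j := fun h0 => h (by rw [← h0, sub_sub_cancel])
      simp [coeff_monomial, hi]
    · obtain ⟨r, rfl⟩ := Nat.exists_eq_succ_of_ne_zero hr.ne'
      simp only [coeff_monomial, Function.iterate_succ_apply]
      split_ifs <;> simp [hc]

theorem coeff_mul_del (P : PseudoDiffOp D) (n : ℤ) : (P * del D).coeff n = P.coeff (n - 1) := by
  rw [del, coeff_mul_monomial P D.map_one_eq_zero, mul_one]

theorem coeff_del_mul (P : PseudoDiffOp D) (n : ℤ) :
    (del D * P).coeff n = P.coeff (n - 1) + D (P.coeff n) := by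
  rw [coeff_mul, finsum_eq_sum_of_support_subset (s := {(1, 0), (1, 1)})]
  · rw [Finset.sum_pair (by simp)]
    simp [coeff_del]
  · rintro ⟨i, r⟩ h
    obtain rfl : i = 1 := by
      by_contra hi
      simp [coeff_del, hi] at h
    obtain hr | hr := le_or_gt r 1
    · interval_cases r <;> simp
    · have hchoose : Ring.choose (1 : ℤ) r = 0 := by
        rw [← Nat.cast_one, Ring.choose_natCast, Nat.choose_eq_zero_of_lt hr, Nat.cast_zero]
      simp [hchoose] at h

theorem del_mul (P : PseudoDiffOp D) : del D * P = P * del D + P.coeffDeriv :=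
  ext_coeff fun n => by rw [coeff_del_mul, coeff_add, coeff_mul_del]; rfl

theorem commute_del (hP : P.coeffDeriv = 0) : Commute (del D) P := by
  rw [Commute, SemiconjBy, del_mul, hP, add_zero]

/-- Multiplication operators, as a homomorphism from the coefficients. -/
def mulByHom (D : Derivation k A A) : A →+* PseudoDiffOp D where
  toFun := mulBy D
  map_one' := rfl
  map_mul' a b := ext_coeff fun n => by rw [coeff_mulBy_mul]; simp [coeff_mulBy]
  map_zero' := ext_coeff fun n => by simp [coeff_mulBy, coeff_zero]
  map_add' a b := ext_coeff fun n => by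
    simp only [coeff_mulBy, coeff_add]
    split_ifs <;> simp

/-- The constants act through multiplication operators, which commute with all operators since
`D` kills them. -/
instance : Algebra k (PseudoDiffOp D) :=
  ((mulByHom D).comp (algebraMap k A)).toAlgebra' fun c P => ext_coeff fun n => by
    change (mulBy D (algebraMap k A c) * P).coeff n = (P * monomial D (algebraMap k A c) 0).coeff n
    rw [coeff_mulBy_mul, coeff_mul_monomial P (D.map_algebraMap c), sub_zero, mul_comm]

theorem algebraMap_eq_mulBy (c : k) :
    algebraMap k (PseudoDiffOp D) c = mulBy D (algebraMap k A c) := rfl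

theorem coeff_smul (c : k) (P : PseudoDiffOp D) (n : ℤ) : (c • P).coeff n = c • P.coeff n := by
  rw [Algebra.smul_def, algebraMap_eq_mulBy, coeff_mulBy_mul, Algebra.smul_def]

/-- The subalgebra of operators without terms of negative degree. -/
def differentialOperators (D : Derivation k A A) : Subalgebra k (PseudoDiffOp D) where
  carrier := {P | ∀ n < 0, P.coeff n = 0}
  add_mem' hP hQ n hn := by rw [coeff_add, hP n hn, hQ n hn, add_zero]
  mul_mem' {P Q} hP hQ n hn := by
    refine finsum_eq_zero_of_forall_eq_zero ?_
    rintro ⟨i, r⟩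
    obtain hi | hi := lt_or_ge i 0
    · rw [hP i hi, zero_mul, smul_zero]
    obtain hj | hj := lt_or_ge (n - i + r) 0
    · rw [hQ _ hj, iterate_map_zero, mul_zero, smul_zero]
    · lift i to ℕ using hi
      rw [Ring.choose_natCast, Nat.choose_eq_zero_of_lt (by omega), Nat.cast_zero, zero_smul]
  algebraMap_mem' _ _ hn := if_neg hn.ne

theorem mulBy_mem_differentialOperators (a : A) : mulBy D a ∈ differentialOperators D :=
  fun _ hn => if_neg hn.ne

theorem del_mem_differentialOperators : del D ∈ differentialOperators D :=
  fun _ hn => if_neg (by omega)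

theorem coeffDeriv_mem_differentialOperators (hP : P ∈ differentialOperators D) :
    P.coeffDeriv ∈ differentialOperators D :=
  fun n hn => (congrArg D (hP n hn)).trans (map_zero D)

theorem nonnegPart_sub (P Q : PseudoDiffOp D) :
    (P - Q).nonnegPart = P.nonnegPart - Q.nonnegPart := ext_coeff fun n => by
  simp only [nonnegPart, coeff_sub]
  split_ifs <;> simp

theorem nonnegPart_of_mem (hP : P ∈ differentialOperators D) : P.nonnegPart = P :=
  ext_coeff fun n => by
    obtain hn | hn := le_or_gt 0 n
    · exact if_pos hn
    · rw [hP n hn]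
      exact if_neg hn.not_ge

/-- `P` has order at most `N`. -/
def HasOrderLE (P : PseudoDiffOp D) (N : ℤ) : Prop := ∀ n, N < n → P.coeff n = 0

theorem HasOrderLE.mul {N M : ℤ} (hP : P.HasOrderLE N) (hQ : Q.HasOrderLE M) :
    (P * Q).HasOrderLE (N + M) :=
  coeff_mul_of_lt P Q hP hQ

theorem HasOrderLE.coeff_mul_add {N M : ℤ} (hP : P.HasOrderLE N) (hQ : Q.HasOrderLE M) :
    (P * Q).coeff (N + M) = P.coeff N * Q.coeff M := by
  simpa using coeff_mul_depth P Q hP hQ 0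

theorem HasOrderLE.nonnegPart (hP : P.HasOrderLE 0) : P.nonnegPart = mulBy D (P.coeff 0) :=
  ext_coeff fun n => by
    obtain hn | rfl | hn := lt_trichotomy n 0
    · exact (if_neg hn.not_ge).trans (if_neg hn.ne).symm
    · rfl
    · rw [coeff_mulBy, if_neg hn.ne', ← hP n hn]
      exact if_pos hn.le

/-- Dressing operators `1 + ∑_{n ≥ 1} v_n ∂⁻ⁿ`. -/
structure IsDressing (P : PseudoDiffOp D) : Prop where
  hasOrderLE : P.HasOrderLE 0
  coeff_zero : P.coeff 0 = 1

theorem IsDressing.coeff_mul_neg_succ (hP : P.IsDressing) (hQ : Q.HasOrderLE 0) (d : ℕ) :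
    (P * Q).coeff (-(d + 1 : ℕ)) = Q.coeff (-(d + 1 : ℕ)) +
      ∑ x ∈ antidiagonal d, ∑ y ∈ antidiagonal x.2,
        Ring.choose (-(x.1 + 1 : ℕ) : ℤ) y.2 •
          (P.coeff (-(x.1 + 1 : ℕ)) * D^[y.2] (Q.coeff (-y.1))) := by
  have h := coeff_mul_depth P Q hP.hasOrderLE hQ (d + 1)
  rw [Finset.Nat.antidiagonal_succ, Finset.sum_cons, Finset.sum_map,
    Finset.sum_eq_single (d + 1, 0)] at h
  · simpa [hP.coeff_zero] using h
  · rintro ⟨i, r⟩ h₁ h₂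
    obtain rfl | hr := r.eq_zero_or_pos
    · simp_all
    · obtain ⟨r, rfl⟩ := Nat.exists_eq_succ_of_ne_zero hr.ne'
      simp [Ring.choose_zero_succ]
  · simp

theorem IsDressing.exists_mul_eq_one (hP : P.IsDressing) :
    ∃ Q : PseudoDiffOp D, Q.IsDressing ∧ P * Q = 1 := by
  obtain ⟨t, ht⟩ := exists_forall_eq_of_lt (B := A) (fun n t => n.casesOn 1 fun d =>
    -∑ x ∈ antidiagonal d, ∑ y ∈ antidiagonal x.2,
      Ring.choose (-(x.1 + 1 : ℕ) : ℤ) y.2 • (P.coeff (-(x.1 + 1 : ℕ)) * D^[y.2] (t y.1))) (by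
    rintro (_ | d) t t' htt'
    · rfl
    · refine congrArg Neg.neg (Finset.sum_congr rfl fun x hx => Finset.sum_congr rfl fun y hy => ?_)
      rw [mem_antidiagonal] at hx hy
      rw [htt' _ (by omega)])
  have hcoeff (d : ℕ) : (ofSymbol D t).coeff (-d) = t d := by simp [ofSymbol]
  have hQ : (ofSymbol D t).IsDressing :=
    ⟨fun _ hn => if_neg hn.not_ge, (hcoeff 0).trans (ht 0)⟩
  refine ⟨ofSymbol D t, hQ, ext_coeff fun n => ?_⟩
  obtain hn | hn := lt_or_ge 0 n
  · rw [hP.hasOrderLE.mul hQ.hasOrderLE n (by simpa using hn), coeff_one, if_neg hn.ne']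
  obtain ⟨d, rfl⟩ : ∃ d : ℕ, n = -d := ⟨n.natAbs, by omega⟩
  cases d with
  | zero => simpa [hP.coeff_zero, hQ.coeff_zero, coeff_one]
      using hP.hasOrderLE.coeff_mul_add hQ.hasOrderLE
  | succ d =>
    rw [hP.coeff_mul_neg_succ hQ.hasOrderLE, coeff_one, if_neg (by omega), hcoeff, ht]
    simp only [hcoeff]
    exact neg_add_cancel _

theorem IsDressing.exists_inverse (hP : P.IsDressing) :
    ∃ Q : PseudoDiffOp D, Q.IsDressing ∧ P * Q = 1 ∧ Q * P = 1 := by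
  obtain ⟨Q, hQ, hPQ⟩ := hP.exists_mul_eq_one
  obtain ⟨R, -, hQR⟩ := hQ.exists_mul_eq_one
  exact ⟨Q, hQ, hPQ, by rwa [left_inv_eq_right_inv hPQ hQR]⟩

variable {V W : PseudoDiffOp D}

theorem isLaxOperator_conj_del (hV : V.IsDressing) (hW : W.IsDressing) (hVW : V * W = 1) :
    (V * del D * W).IsLaxOperator := by
  have hconj : V * del D * W = del D - V.coeffDeriv * W := by
    rw [eq_sub_of_add_eq (del_mul V).symm, sub_mul, mul_assoc, hVW, mul_one]
  have horder : V.coeffDeriv.HasOrderLE (-1) := fun n hn => by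
    obtain rfl | hn := (Int.add_one_le_of_lt hn).eq_or_lt
    · exact (congrArg D hV.coeff_zero).trans D.map_one_eq_zero
    · exact (congrArg D (hV.hasOrderLE n hn)).trans (map_zero D)
  have hcoeff (n : ℤ) (hn : -1 < n) : (V * del D * W).coeff n = (del D).coeff n := by
    rw [hconj, coeff_sub, horder.mul hW.hasOrderLE n (by simpa using hn), sub_zero]
  refine ⟨fun n hn => ?_, ?_, ?_⟩
  · rw [hcoeff n (by omega), coeff_del, if_neg hn.ne']
  · rw [hcoeff 1 (by norm_num), coeff_del, if_pos rfl]
  · rw [hcoeff 0 (by norm_num), coeff_del, if_neg zero_ne_one]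

theorem nonnegPart_conj_del_pow (hV : V.IsDressing) (hW : W.IsDressing) (hVW : V * W = 1)
    (hWV : W * V = 1) {E : PseudoDiffOp D} (hE : E.HasOrderLE 0) {c : k}
    (hc : E.coeff 0 = algebraMap k A c) {n : ℕ}
    (hmem : V * (del D ^ n + E) * W ∈ differentialOperators D) :
    ((V * del D * W) ^ n).nonnegPart =
      V * (del D ^ n + E) * W - algebraMap k (PseudoDiffOp D) c := by
  have hpow : (V * del D * W) ^ n = V * (del D ^ n + E) * W - V * E * W := by
    rw [← sub_mul, ← mul_sub, add_sub_cancel_right]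
    exact Units.conj_pow ⟨V, W, hVW, hWV⟩ (del D) n
  have hcoeff : (V * E * W).coeff 0 = algebraMap k A c := by
    have hVE : (V * E).coeff 0 = V.coeff 0 * E.coeff 0 := hV.hasOrderLE.coeff_mul_add hE
    have hVEW : (V * E * W).coeff 0 = (V * E).coeff 0 * W.coeff 0 :=
      (hV.hasOrderLE.mul hE).coeff_mul_add hW.hasOrderLE
    rw [hVEW, hVE, hV.coeff_zero, hW.coeff_zero, hc, one_mul, mul_one]
  rw [hpow, nonnegPart_sub, nonnegPart_of_mem hmem,
    HasOrderLE.nonnegPart ((hV.hasOrderLE.mul hE).mul hW.hasOrderLE), hcoeff, algebraMap_eq_mulBy]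

theorem commute_conj (hWV : W * V = 1) (h : Commute P Q) :
    Commute (V * P * W) (V * Q * W) := by
  have hmul (R S : PseudoDiffOp D) : V * R * W * (V * S * W) = V * (R * S) * W := by
    simp only [mul_assoc]
    rw [← mul_assoc W V, hWV, one_mul]
  rw [Commute, SemiconjBy, hmul, hmul, h.eq]

theorem isStationaryKP_conj_del (hV : V.IsDressing) (hW : W.IsDressing) (hVW : V * W = 1)
    (hWV : W * V = 1) {E : ℕ → PseudoDiffOp D} (hE : ∀ n, (E n).HasOrderLE 0)
    (hderiv : ∀ n, (E n).coeffDeriv = 0) {c : ℕ → k}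
    (hc : ∀ n, (E n).coeff 0 = algebraMap k A (c n))
    (hmem : ∀ n, V * (del D ^ (n + 2) + E n) * W ∈ differentialOperators D) :
    (V * del D * W).IsStationaryKP := by
  refine ⟨isLaxOperator_conj_del hV hW hVW, fun n => ?_⟩
  rw [nonnegPart_conj_del_pow hV hW hVW hWV (hE n) (hc n) (hmem n)]
  have hcomm : Commute (V * (del D ^ (n + 2) + E n) * W) (V * del D * W) :=
    commute_conj hWV (((Commute.refl _).pow_left _).add_left (commute_del (hderiv n)).symm)
  exact (hcomm.sub_left (Algebra.commute_algebraMap_left _ _)).lie_eq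

end Ring

end PseudoDiffOp

namespace KPLame

open LaurentSeries PowerSeries Filter Topology

-- Without this, `HahnSeries.powerSeriesAlgebra` is found first, whose scalar action agrees with the
-- coefficientwise one only propositionally.
local instance {k A : Type*} [CommRing k] [CommRing A] [Algebra k A] : Algebra k A⸨X⸩ :=
  HahnSeries.instAlgebra

section LaurentDerivation

variable {k A : Type*} [CommRing k] [CommRing A] [Algebra k A]

/-- The derivation of Laurent series acting on the coefficient of `Xⁿ` by `φ n`, where the maps
`φ n` satisfy the graded Leibniz rule. -/
def gradedDerivation (φ : ℤ → A →ₗ[k] A)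
    (hφ : ∀ i j a b, φ (i + j) (a * b) = a * φ j b + b * φ i a) :
    Derivation k A⸨X⸩ A⸨X⸩ :=
  Derivation.mk'
    { toFun := fun s => ⟨fun n => φ n (s.coeff n), s.isPWO_support.mono fun n hn h =>
        hn (by simp only [h, map_zero])⟩
      map_add' := fun s t => HahnSeries.ext <| funext fun n => map_add (φ n) _ _
      map_smul' := fun c s => HahnSeries.ext <| funext fun n => map_smul (φ n) c _ }
    (fun s t => HahnSeries.ext <| funext fun n => by
      have hsub (u : A⸨X⸩) {h} : (⟨fun n => φ n (u.coeff n), h⟩ : A⸨X⸩).support ⊆ u.support :=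
        fun m hm h => hm (by simp only [h, map_zero])
      rw [smul_eq_mul, smul_eq_mul, mul_comm t]
      simp only [LinearMap.coe_mk, AddHom.coe_mk, HahnSeries.coeff_add]
      rw [HahnSeries.coeff_mul, HahnSeries.coeff_mul_right' t.isPWO_support (hsub t),
        HahnSeries.coeff_mul_left' s.isPWO_support (hsub s), map_sum, ← Finset.sum_add_distrib]
      refine Finset.sum_congr rfl fun x hx => ?_
      obtain ⟨-, -, rfl⟩ := Finset.mem_antidiagonal.mp hx
      rw [hφ, mul_comm (φ _ _)])

/-- The coefficientwise extension to Laurent series of a derivation of the coefficients. -/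
def coeffDerivation (D : Derivation k A A) : Derivation k A⸨X⸩ A⸨X⸩ :=
  gradedDerivation (fun _ => D) fun _ _ => D.leibniz

/-- The derivation `X d/dX` of Laurent series. -/
def eulerDerivation (k A : Type*) [CommRing k] [CommRing A] [Algebra k A] :
    Derivation k A⸨X⸩ A⸨X⸩ :=
  gradedDerivation (fun n => n • LinearMap.id) fun i j a b => by
    change (i + j) • (a * b) = a * j • b + b * i • a
    simp only [zsmul_eq_mul, Int.cast_add]
    ring

theorem derivative_eq_single_mul_eulerDerivation (s : A⸨X⸩) :
    LaurentSeries.derivative k s = HahnSeries.single (-1) 1 * eulerDerivation k A s := by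
  ext n
  rw [HahnSeries.coeff_single_mul, one_mul, sub_neg_eq_add, LaurentSeries.derivative_apply,
    hasseDeriv_coeff, Nat.cast_one, Ring.choose_one_right]
  rfl

/-- `LaurentSeries.derivative` as a derivation. -/
def laurentDeriv (k A : Type*) [CommRing k] [CommRing A] [Algebra k A] : Derivation k A⸨X⸩ A⸨X⸩ :=
  Derivation.mk' (LaurentSeries.derivative k) fun s t => by
    simp only [derivative_eq_single_mul_eulerDerivation, Derivation.leibniz, smul_eq_mul]
    ring

variable (D : Derivation k A A)

theorem coeff_coeffDerivation (s : A⸨X⸩) (n : ℤ) :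
    (coeffDerivation D s).coeff n = D (s.coeff n) := rfl

theorem coeff_laurentDeriv (s : A⸨X⸩) (n : ℤ) :
    (laurentDeriv k A s).coeff n = (n + 1) * s.coeff (n + 1) := by
  change (LaurentSeries.derivative k s).coeff n = _
  rw [LaurentSeries.derivative_apply, hasseDeriv_coeff, Nat.cast_one, Ring.choose_one_right,
    zsmul_eq_mul, Int.cast_add, Int.cast_one]

theorem coeffDerivation_zero (s : A⸨X⸩) : coeffDerivation (0 : Derivation k A A) s = 0 := by
  ext n
  rw [coeff_coeffDerivation, Derivation.zero_apply, HahnSeries.coeff_zero]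

theorem laurentDeriv_coeffDerivation (s : A⸨X⸩) :
    laurentDeriv k A (coeffDerivation D s) = coeffDerivation D (laurentDeriv k A s) := by
  ext n
  simp [coeff_laurentDeriv, coeff_coeffDerivation]

/-- The Laurent series `X⁻¹`, the symbol of `∂`. -/
def invX (A : Type*) [CommRing A] : A⸨X⸩ := HahnSeries.single (-1) 1

theorem invX_mul_X : invX A * (X : A⟦X⟧) = 1 := by
  rw [invX, PowerSeries.coe_X, HahnSeries.single_mul_single, mul_one]
  rfl

theorem isUnit_invX : IsUnit (invX A) := .of_mul_eq_one _ invX_mul_X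

theorem laurentDeriv_invX : laurentDeriv k A (invX A) = -invX A ^ 2 := by
  rw [invX, sq, HahnSeries.single_mul_single, mul_one]
  ext n
  rw [coeff_laurentDeriv, HahnSeries.coeff_neg]
  obtain rfl | hn := eq_or_ne n (-2)
  · norm_num
  · rw [HahnSeries.coeff_single_of_ne (by omega), HahnSeries.coeff_single_of_ne (by omega),
      mul_zero, neg_zero]

theorem laurentDeriv_C (a : A) : laurentDeriv k A (HahnSeries.C a) = 0 := by
  ext n
  rw [coeff_laurentDeriv, HahnSeries.C_apply, HahnSeries.coeff_single]
  split_ifs with hn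
  · rw [← Int.cast_one, ← Int.cast_add, hn, Int.cast_zero, zero_mul, HahnSeries.coeff_zero]
  · rw [mul_zero, HahnSeries.coeff_zero]

theorem coeffDerivation_C (a : A) :
    coeffDerivation D (HahnSeries.C a) = HahnSeries.C (D a) := by
  ext n
  rw [coeff_coeffDerivation, HahnSeries.C_apply, HahnSeries.C_apply, HahnSeries.coeff_single,
    HahnSeries.coeff_single]
  split_ifs
  exacts [rfl, map_zero D]

theorem coeffDerivation_invX : coeffDerivation D (invX A) = 0 := by
  ext n
  rw [coeff_coeffDerivation, invX, HahnSeries.coeff_single]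
  split_ifs
  exacts [D.map_one_eq_zero, map_zero D]

theorem coeff_coe_of_neg (s : A⟦X⟧) {n : ℤ} (hn : n < 0) : (s : A⸨X⸩).coeff n = 0 := by
  rw [PowerSeries.coeff_coe, if_pos hn]

theorem coeffDerivation_map_algebraMap (s : k⟦X⟧) :
    coeffDerivation D (PowerSeries.map (algebraMap k A) s : A⟦X⟧) = 0 := by
  ext n
  rw [coeff_coeffDerivation, PowerSeries.coeff_coe]
  split_ifs
  exacts [map_zero D, by rw [coeff_map, D.map_algebraMap]; rfl]

theorem laurentDeriv_coe (s : A⟦X⟧) : laurentDeriv k A s = (derivative A s : A⟦X⟧) := by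
  ext n
  rw [coeff_laurentDeriv]
  obtain hn | hn := lt_or_ge n 0
  · rw [coeff_coe_of_neg _ hn]
    obtain hn | hn := (Int.add_one_le_of_lt hn).lt_or_eq
    · rw [coeff_coe_of_neg _ hn, mul_zero]
    · rw [← Int.cast_one, ← Int.cast_add, hn, Int.cast_zero, zero_mul]
  · lift n to ℕ using hn
    rw [← Nat.cast_succ, coeff_coe_powerSeries, coeff_coe_powerSeries, coeff_derivative]
    push_cast
    ring

end LaurentDerivation

section LinearODE

variable {k A : Type*} [Field k] [CharZero k] [CommRing A] [Algebra k A]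

theorem eq_zero_of_laurentDeriv_add_eq_mul (D : Derivation k A A) {s t : A⸨X⸩}
    (ht : ∀ n < 0, t.coeff n = 0) (hs : ∀ n ≤ 0, s.coeff n = 0)
    (h : laurentDeriv k A s + coeffDerivation D s = t * s) : s = 0 := by
  have hcoeff (n : ℕ) : ∀ m ≤ (n : ℤ), s.coeff m = 0 := by
    induction n with
    | zero => exact_mod_cast hs
    | succ n ih =>
      intro m hm
      obtain hm | rfl := hm.lt_or_eq
      · exact ih m (by push_cast at hm; omega)
      have hmul : (t * s).coeff n = 0 := by
        rw [HahnSeries.coeff_mul]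
        refine Finset.sum_eq_zero fun x hx => ?_
        obtain ⟨hxt, hxs, hx⟩ := Finset.mem_antidiagonal.mp hx
        exact absurd (ih _ (by have := not_lt.mp (mt (ht _) hxt); omega)) hxs
      have hunit : IsUnit (((n : ℤ) : A) + 1) := by
        simpa using (IsUnit.mk0 ((n : k) + 1) n.cast_add_one_ne_zero).map (algebraMap k A)
      rw [← h, HahnSeries.coeff_add, coeff_laurentDeriv, coeff_coeffDerivation, ih n le_rfl,
        map_zero, add_zero] at hmul
      exact_mod_cast hunit.mul_right_eq_zero.mp hmul
  ext m
  exact hcoeff m.toNat m (Int.self_le_toNat m)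

theorem map_derivative {R S : Type*} [CommRing R] [CommRing S] (φ : R →+* S) (s : R⟦X⟧) :
    PowerSeries.map φ (d⁄dX R s) = d⁄dX S (PowerSeries.map φ s) := by
  ext n
  simp [coeff_derivative]

theorem eq_zero_of_derivative_eq_mul {A : Type*} [CommRing A] [Algebra ℚ A] {s t : A⟦X⟧}
    (hs : constantCoeff s = 0) (h : d⁄dX A s = t * s) : s = 0 := by
  refine HahnSeries.ofPowerSeries_injective (Γ := ℤ) ?_
  rw [map_zero]
  refine eq_zero_of_laurentDeriv_add_eq_mul (0 : Derivation ℚ A A) (t := (t : A⸨X⸩))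
    (fun n => coeff_coe_of_neg _) (fun n hn => ?_) ?_
  · obtain hn | rfl := hn.lt_or_eq
    · exact coeff_coe_of_neg s hn
    · rw [← Int.natCast_zero, coeff_coe_powerSeries, coeff_zero_eq_constantCoeff_apply, hs]
  · rw [coeffDerivation_zero, add_zero, laurentDeriv_coe, h, map_mul]

theorem exists_derivative_eq_mul {A : Type*} [CommRing A] [Algebra ℚ A] (s : A⟦X⟧) :
    ∃ t : A⟦X⟧, constantCoeff t = 1 ∧ d⁄dX A t = s * t := by
  obtain ⟨t, ht⟩ := exists_forall_eq_of_lt (B := A) (fun n t => n.casesOn 1 fun n =>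
    (n + 1 : ℚ)⁻¹ • ∑ x ∈ Finset.HasAntidiagonal.antidiagonal n,
      PowerSeries.coeff x.1 s * t x.2) (by
    rintro (_ | n) t t' htt'
    · rfl
    · refine congrArg _ (Finset.sum_congr rfl fun x hx => ?_)
      rw [Finset.HasAntidiagonal.mem_antidiagonal] at hx
      rw [htt' _ (by omega)])
  refine ⟨.mk t, ?_, PowerSeries.ext fun n => ?_⟩
  · rw [← coeff_zero_eq_constantCoeff_apply, coeff_mk]
    exact ht 0
  · have hn : (n + 1 : A) = algebraMap ℚ A (n + 1) := by simp
    rw [coeff_derivative, coeff_mk, ht, PowerSeries.coeff_mul, hn, mul_comm, ← Algebra.smul_def,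
      smul_smul, mul_inv_cancel₀ n.cast_add_one_ne_zero, one_smul]
    simp only [coeff_mk]

end LinearODE

section Symbols

variable {k A : Type*} [CommRing k] [CommRing A] [Algebra k A] (D : Derivation k A A)

open PseudoDiffOp (ext_coeff mulBy del)

/-- The operator whose symbol is a given Laurent series in `X = ∂⁻¹`. -/
def ofLaurent : A⸨X⸩ →ₗ[k] PseudoDiffOp D where
  toFun s := ⟨fun n => s.coeff (-n), -s.order, fun _ hn =>
    HahnSeries.coeff_eq_zero_of_lt_order (neg_lt.mp hn)⟩
  map_add' _ _ := rfl
  map_smul' _ _ := ext_coeff fun _ => by rw [RingHom.id_apply, PseudoDiffOp.coeff_smul]; rfl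

theorem coeff_ofLaurent (s : A⸨X⸩) (n : ℤ) : (ofLaurent D s).coeff n = s.coeff (-n) := rfl

theorem algebraMap_mul_ofLaurent (c : k) (s : A⸨X⸩) :
    algebraMap k (PseudoDiffOp D) c * ofLaurent D s =
      ofLaurent D (algebraMap k A⸨X⸩ c * s) := by
  rw [← Algebra.smul_def, ← Algebra.smul_def, LinearMap.map_smul]

theorem ofLaurent_one : ofLaurent D 1 = 1 := by
  refine ext_coeff fun n => ?_
  rw [coeff_ofLaurent, HahnSeries.coeff_one, PseudoDiffOp.coeff_one]
  simp only [neg_eq_zero]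

theorem ofLaurent_coe (s : A⟦X⟧) :
    ofLaurent D (s : A⸨X⸩) = PseudoDiffOp.ofSymbol D fun n => PowerSeries.coeff n s := by
  refine ext_coeff fun n => ?_
  rw [coeff_ofLaurent]
  obtain hn | hn := lt_or_ge 0 n
  · rw [coeff_coe_of_neg _ (neg_neg_of_pos hn)]
    exact (if_neg hn.not_ge).symm
  · obtain ⟨d, rfl⟩ : ∃ d : ℕ, n = -d := ⟨n.natAbs, by omega⟩
    rw [neg_neg, coeff_coe_powerSeries]
    simp [PseudoDiffOp.ofSymbol]

theorem mulBy_mul_ofLaurent (a : A) (s : A⸨X⸩) :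
    mulBy D a * ofLaurent D s = ofLaurent D (HahnSeries.C a * s) := by
  refine ext_coeff fun n => ?_
  rw [PseudoDiffOp.coeff_mulBy_mul, coeff_ofLaurent, coeff_ofLaurent, HahnSeries.C_mul_eq_smul,
    HahnSeries.coeff_smul, smul_eq_mul]

theorem del_mul_ofLaurent (s : A⸨X⸩) : del D * ofLaurent D s =
    ofLaurent D (coeffDerivation D s + invX A * s) := by
  refine ext_coeff fun n => ?_
  rw [PseudoDiffOp.coeff_del_mul, coeff_ofLaurent, coeff_ofLaurent, coeff_ofLaurent,
    HahnSeries.coeff_add, invX, HahnSeries.coeff_single_mul, one_mul, coeff_coeffDerivation,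
    add_comm, neg_sub, sub_neg_eq_add, neg_add_eq_sub]

theorem ofLaurent_mul_ofLaurent (s : A⸨X⸩) {t : A⸨X⸩} (ht : coeffDerivation D t = 0) :
    ofLaurent D s * ofLaurent D t = ofLaurent D (s * t) := by
  refine ext_coeff fun n => ?_
  have hiter (r : ℕ) (j : ℤ) : D^[r + 1] (t.coeff j) = 0 := by
    rw [Function.iterate_succ_apply, ← coeff_coeffDerivation, ht, HahnSeries.coeff_zero,
      iterate_map_zero]
  rw [PseudoDiffOp.coeff_mul, coeff_ofLaurent, HahnSeries.coeff_mul,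
    finsum_eq_sum_of_support_subset (s := (Finset.antidiagonal s.isPWO_support t.isPWO_support
      (-n)).image fun x => ((-x.1, 0) : ℤ × ℕ)), Finset.sum_image]
  · refine Finset.sum_congr rfl fun x hx => ?_
    obtain ⟨-, -, hx⟩ := Finset.mem_antidiagonal.mp hx
    have hj : -x.1 + -n = x.2 := by omega
    simp [coeff_ofLaurent, hj]
  · intro x hx y hy hxy
    have hx' := (Finset.mem_antidiagonal.mp hx).2.2
    have hy' := (Finset.mem_antidiagonal.mp hy).2.2
    simp only [Prod.mk.injEq, neg_inj, and_true] at hxy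
    exact Prod.ext hxy (by omega)
  · rintro ⟨i, r⟩ h
    rcases r with _ | r
    · have hi : s.coeff (-i) * t.coeff (-(n - i)) ≠ 0 := by simpa [coeff_ofLaurent] using h
      refine Finset.mem_coe.mpr (Finset.mem_image.mpr ⟨(-i, -(n - i)), ?_, by simp⟩)
      exact Finset.mem_antidiagonal.mpr
        ⟨left_ne_zero_of_mul hi, right_ne_zero_of_mul hi, by omega⟩
    · simp [coeff_ofLaurent, hiter] at h

theorem del_pow_eq_ofLaurent (n : ℕ) : del D ^ n = ofLaurent D (invX A ^ n) := by
  induction n with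
  | zero => rw [pow_zero, pow_zero, ofLaurent_one]
  | succ n ih =>
    rw [pow_succ', ih, del_mul_ofLaurent, Derivation.leibniz_pow, coeffDerivation_invX, smul_zero,
      smul_zero, zero_add, pow_succ']

end Symbols

section Weierstrass

variable {k B : Type*} [Field k] [CharZero k] [CommRing B] [Algebra k B]

theorem two_mul_algebraMap_div_two (c : k) :
    2 * algebraMap k B (c / 2) = algebraMap k B c := by
  rw [← map_ofNat (algebraMap k B) 2, ← map_mul, mul_div_cancel₀ _ two_ne_zero]

theorem derivation_derivation_eq_of_sq_eq (δ : Derivation k B B) {w : B} {g₂ g₃ : k}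
    (hw : IsUnit (δ w))
    (h : δ w ^ 2 = 4 * w ^ 3 - algebraMap k B g₂ * w - algebraMap k B g₃) :
    δ (δ w) = 6 * w ^ 2 - algebraMap k B (g₂ / 2) := by
  have h2 : (2 : B) * algebraMap k B (1 / 2) = 1 := by
    rw [← map_ofNat (algebraMap k B) 2, ← map_mul, mul_one_div_cancel two_ne_zero, map_one]
  have h4 : δ 4 = 0 := by rw [← map_ofNat (algebraMap k B) 4, δ.map_algebraMap]
  have hδ := congrArg δ h
  simp only [Derivation.leibniz_pow, map_sub, Derivation.leibniz, Derivation.map_algebraMap, h4,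
    smul_eq_mul, nsmul_eq_mul] at hδ
  refine hw.mul_left_cancel ?_
  rw [div_eq_mul_one_div, map_mul]
  push_cast at hδ
  linear_combination algebraMap k B (1 / 2) * hδ -
    (δ w * δ (δ w) - 6 * w ^ 2 * δ w) * h2

end Weierstrass

section Shift

variable {k A : Type*} [Field k] [CommRing A] [Algebra k A] (D : Derivation k A A)

/-- The Taylor expansion of `s (x - X)` in powers of `X`, where `D` plays the role of `d/dx`. -/
def shift : A →ₗ[k] A⟦X⟧ where
  toFun s := .mk fun n => ((-1) ^ n / n.factorial : k) • D^[n] s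
  map_add' s t := PowerSeries.ext fun n => by simp [iterate_map_add]
  map_smul' c s := PowerSeries.ext fun n => by
    simp [← Derivation.coeFn_coe, ← Module.End.pow_apply, smul_comm c]

theorem coeff_shift (s : A) (n : ℕ) :
    PowerSeries.coeff n (shift D s) = ((-1) ^ n / n.factorial : k) • D^[n] s := by
  simp [shift]

theorem constantCoeff_shift (s : A) : constantCoeff (shift D s) = s := by
  rw [← coeff_zero_eq_constantCoeff_apply, coeff_shift]
  simp

theorem derivative_shift [CharZero k] (s : A) : d⁄dX A (shift D s) = -shift D (D s) := by
  ext n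
  have hn : ((-1) ^ (n + 1) / (n + 1).factorial : k) * (n + 1) = -((-1) ^ n / n.factorial) := by
    rw [Nat.factorial_succ]
    push_cast
    have := Nat.cast_add_one_ne_zero (R := k) n
    field_simp
    ring
  rw [coeff_derivative, map_neg, coeff_shift, coeff_shift, Function.iterate_succ_apply,
    smul_mul_assoc, mul_comm, ← neg_smul, ← hn, mul_smul, Algebra.smul_def (_ + 1 : k)]
  simp

theorem coeffDerivation_shift (s : A) :
    coeffDerivation D (shift D s : A⟦X⟧) = (shift D (D s) : A⟦X⟧) := by
  ext n
  rw [coeff_coeffDerivation]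
  obtain hn | hn := lt_or_ge n 0
  · rw [coeff_coe_of_neg _ hn, coeff_coe_of_neg _ hn, map_zero]
  · lift n to ℕ using hn
    rw [coeff_coe_powerSeries, coeff_coe_powerSeries, coeff_shift, coeff_shift, D.map_smul,
      ← Function.iterate_succ_apply' D, Function.iterate_succ_apply]

end Shift

/-- The local data of a Weierstrass curve: `p`, `z`, `x` stand for `℘(x)`, `ζ(x)` and the
coordinate, `D` for `d/dx`, and `a n` for the coefficients of `℘(X) - X⁻²`, so that `expansion` is
the differential equation `℘'² = 4℘³ - g₂℘ - g₃` for `℘(X)`, multiplied by `X⁶`. -/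
structure LameData {k A : Type*} [Field k] [CommRing A] [Algebra k A] (D : Derivation k A A) where
  p : A
  z : A
  x : A
  g₂ : k
  g₃ : k
  a : ℕ → k
  deriv_z : D z = -p
  deriv_x : D x = 1
  deriv_p_sq : D p ^ 2 = 4 * p ^ 3 - algebraMap k A g₂ * p - algebraMap k A g₃
  deriv_deriv_p : D (D p) = 6 * p ^ 2 - algebraMap k A (g₂ / 2)
  even : ∀ n, (-1) ^ n * a n = a n
  expansion : (X ^ 3 * d⁄dX k (.mk a) - 2) ^ 2 =
    4 * (1 + X ^ 2 * .mk a) ^ 3 - C g₂ * X ^ 4 * (1 + X ^ 2 * .mk a) - C g₃ * X ^ 6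

namespace LameData

section Field

variable {k A : Type*} [Field k] [CommRing A] [Algebra k A] {D : Derivation k A A}
  (S : LameData D)

/-- The power series `℘(X) - X⁻²`. -/
def wpRegular : A⟦X⟧ := PowerSeries.map (algebraMap k A) (.mk S.a)

/-- The Laurent series `℘(X)`. -/
def wpSeries : A⸨X⸩ := invX A ^ 2 + S.wpRegular

/-- The power series `ζ(X) - X⁻¹`. -/
def zetaRegular : A⟦X⟧ := -(X * PowerSeries.map (algebraMap k A) (.mk fun n => S.a n / (n + 1)))

/-- The power series `ζ(x - X) - ζ(x) + ζ(X) - X⁻¹`. -/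
def zetaRegularDiff : A⟦X⟧ := shift D S.z - C S.z + S.zetaRegular

/-- The Laurent series `ζ(x - X) - ζ(x) + ζ(X)`. -/
def zetaDiff : A⸨X⸩ := invX A + S.zetaRegularDiff

theorem wpSeries_eq : S.wpSeries = invX A ^ 2 * (1 + X ^ 2 * S.wpRegular : A⟦X⟧) := by
  have hX := invX_mul_X (A := A)
  rw [wpSeries]
  push_cast
  linear_combination -(invX A * (X : A⟦X⟧) + 1) * (S.wpRegular : A⸨X⸩) * hX

theorem laurentDeriv_wpSeries : laurentDeriv k A S.wpSeries =
    invX A ^ 3 * (X ^ 3 * d⁄dX A S.wpRegular - 2 : A⟦X⟧) := by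
  have hX := invX_mul_X (A := A)
  rw [wpSeries, map_add, laurentDeriv_coe, Derivation.leibniz_pow, laurentDeriv_invX]
  simp only [smul_eq_mul, nsmul_eq_mul]
  push_cast [map_ofNat]
  linear_combination -((invX A * (X : A⟦X⟧)) ^ 2 + invX A * (X : A⟦X⟧) + 1) *
    (d⁄dX A S.wpRegular : A⟦X⟧) * hX

theorem derivative_wpRegular :
    d⁄dX A S.wpRegular = PowerSeries.map (algebraMap k A) (d⁄dX k (.mk S.a)) := by
  ext n
  simp [wpRegular, coeff_derivative]

theorem wpRegular_expansion : (X ^ 3 * d⁄dX A S.wpRegular - 2) ^ 2 =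
    4 * (1 + X ^ 2 * S.wpRegular) ^ 3 -
      C (algebraMap k A S.g₂) * X ^ 4 * (1 + X ^ 2 * S.wpRegular) -
      C (algebraMap k A S.g₃) * X ^ 6 := by
  rw [derivative_wpRegular, wpRegular]
  simpa [map_ofNat (PowerSeries.map (algebraMap k A))] using
    congrArg (PowerSeries.map (algebraMap k A)) S.expansion

theorem laurentDeriv_wpSeries_sq : laurentDeriv k A S.wpSeries ^ 2 = 4 * S.wpSeries ^ 3 -
    algebraMap k A⸨X⸩ S.g₂ * S.wpSeries - algebraMap k A⸨X⸩ S.g₃ := by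
  have hX (n : ℕ) : invX A ^ n * (X : A⟦X⟧) ^ n = 1 := by rw [← mul_pow, invX_mul_X, one_pow]
  have h := congrArg (HahnSeries.ofPowerSeries ℤ A) S.wpRegular_expansion
  rw [laurentDeriv_wpSeries, wpSeries_eq, HahnSeries.algebraMap_apply, HahnSeries.algebraMap_apply]
  push_cast [map_ofNat, PowerSeries.coe_C] at h ⊢
  linear_combination invX A ^ 6 * h -
    HahnSeries.C (algebraMap k A S.g₂) * invX A ^ 2 *
      (1 + (X : A⟦X⟧) ^ 2 * (S.wpRegular : A⸨X⸩)) * hX 4 -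
    HahnSeries.C (algebraMap k A S.g₃) * hX 6

theorem coeffDerivation_wpSeries : coeffDerivation D S.wpSeries = 0 := by
  rw [wpSeries, map_add, wpRegular, coeffDerivation_map_algebraMap, Derivation.leibniz_pow,
    coeffDerivation_invX, smul_zero, smul_zero, add_zero]

theorem isUnit_laurentDeriv_wpSeries [CharZero k] : IsUnit (laurentDeriv k A S.wpSeries) := by
  rw [laurentDeriv_wpSeries]
  refine (isUnit_invX.pow 3).mul (IsUnit.map (HahnSeries.ofPowerSeries ℤ A) ?_)
  rw [isUnit_iff_constantCoeff]
  have h : IsUnit (algebraMap k A 2) := (IsUnit.mk0 _ two_ne_zero).map _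
  rw [map_ofNat] at h
  simpa [map_ofNat (constantCoeff (R := A))] using h

theorem laurentDeriv_laurentDeriv_wpSeries [CharZero k] :
    laurentDeriv k A (laurentDeriv k A S.wpSeries) =
      6 * S.wpSeries ^ 2 - algebraMap k A⸨X⸩ (S.g₂ / 2) :=
  derivation_derivation_eq_of_sq_eq _ S.isUnit_laurentDeriv_wpSeries S.laurentDeriv_wpSeries_sq

theorem derivative_zetaRegular [CharZero k] : d⁄dX A S.zetaRegular = -S.wpRegular := by
  ext n
  have hn : algebraMap k A (S.a n / (n + 1)) * (n + 1) = algebraMap k A (S.a n) := by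
    rw [← map_natCast (algebraMap k A), ← map_one (algebraMap k A), ← map_add, ← map_mul,
      div_mul_cancel₀ _ n.cast_add_one_ne_zero]
  rw [coeff_derivative, zetaRegular, map_neg, map_neg, coeff_succ_X_mul, wpRegular, coeff_map,
    coeff_map, coeff_mk, coeff_mk, neg_mul, hn]

theorem coeffDerivation_zetaRegular : coeffDerivation D (S.zetaRegular : A⸨X⸩) = 0 := by
  rw [zetaRegular, ← map_X (algebraMap k A), ← map_mul, ← map_neg, coeffDerivation_map_algebraMap]

theorem constantCoeff_zetaRegularDiff : constantCoeff S.zetaRegularDiff = 0 := by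
  simp [zetaRegularDiff, constantCoeff_shift, zetaRegular]

theorem derivative_zetaRegularDiff [CharZero k] :
    d⁄dX A S.zetaRegularDiff = shift D S.p - S.wpRegular := by
  rw [zetaRegularDiff, map_add, map_sub, derivative_shift, derivative_C, derivative_zetaRegular,
    S.deriv_z, map_neg]
  ring

theorem coeffDerivation_zetaRegularDiff : coeffDerivation D (S.zetaRegularDiff : A⸨X⸩) =
    (HahnSeries.C S.p : A⸨X⸩) - (shift D S.p : A⟦X⟧) := by
  rw [zetaRegularDiff]
  push_cast
  rw [map_add, map_sub, coeffDerivation_zetaRegular, coeffDerivation_shift, PowerSeries.coe_C,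
    coeffDerivation_C, S.deriv_z, map_neg, map_neg, map_neg HahnSeries.C]
  ring

theorem laurentDeriv_add_coeffDerivation_zetaDiff [CharZero k] :
    (laurentDeriv k A + coeffDerivation D) S.zetaDiff = HahnSeries.C S.p - S.wpSeries := by
  rw [Derivation.add_apply, zetaDiff, map_add, map_add, laurentDeriv_invX, coeffDerivation_invX,
    laurentDeriv_coe, derivative_zetaRegularDiff, coeffDerivation_zetaRegularDiff, wpSeries]
  push_cast [PowerSeries.coe_C]
  ring

theorem C_sub_wpSeries_eq : (HahnSeries.C S.p : A⸨X⸩) - S.wpSeries =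
    invX A ^ 2 * (X ^ 2 * (C S.p - S.wpRegular) - 1 : A⟦X⟧) := by
  rw [wpSeries]
  push_cast [PowerSeries.coe_C]
  linear_combination -(invX A * (X : A⟦X⟧) + 1) *
    (HahnSeries.C S.p - (S.wpRegular : A⸨X⸩)) * invX_mul_X (A := A)

theorem isUnit_X_sq_mul_sub_one : IsUnit (X ^ 2 * (C S.p - S.wpRegular) - 1 : A⟦X⟧) :=
  isUnit_iff_constantCoeff.mpr (by simp)

theorem isUnit_C_sub_wpSeries : IsUnit ((HahnSeries.C S.p : A⸨X⸩) - S.wpSeries) := by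
  rw [C_sub_wpSeries_eq]
  exact (isUnit_invX.pow 2).mul (S.isUnit_X_sq_mul_sub_one.map (HahnSeries.ofPowerSeries ℤ A))

/-- The difference of the two sides of the addition theorem
`2 (℘(x) - ℘(X)) (ζ(x - X) - ζ(x) + ζ(X)) = ℘'(x) + ℘'(X)`. -/
def additionDefect : A⸨X⸩ :=
  2 * (HahnSeries.C S.p - S.wpSeries) * S.zetaDiff -
    (HahnSeries.C (D S.p) + laurentDeriv k A S.wpSeries)

theorem exists_additionDefect_eq_mul : ∃ q : A⟦X⟧, constantCoeff q = 0 ∧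
    S.additionDefect = (HahnSeries.C S.p - S.wpSeries) * (q : A⸨X⸩) := by
  obtain ⟨Z, hZ⟩ := X_dvd_iff.mpr S.constantCoeff_zetaRegularDiff
  obtain ⟨V, hV⟩ := S.isUnit_X_sq_mul_sub_one.exists_right_inv
  obtain ⟨U, hU⟩ : ∃ U, U = C S.p - S.wpRegular := ⟨_, rfl⟩
  obtain ⟨G, hG⟩ : ∃ G, G = 2 * (U * (1 + X * S.zetaRegularDiff) - Z) -
    X * (C (D S.p) + d⁄dX A S.wpRegular) := ⟨_, rfl⟩
  refine ⟨X * V * G, by simp, ?_⟩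
  have hX := invX_mul_X (A := A)
  rw [additionDefect, C_sub_wpSeries_eq, laurentDeriv_wpSeries, zetaDiff, ← hU]
  rw [← hU] at hV
  replace hZ := congrArg (HahnSeries.ofPowerSeries ℤ A) hZ
  replace hV := congrArg (HahnSeries.ofPowerSeries ℤ A) hV
  replace hG := congrArg (HahnSeries.ofPowerSeries ℤ A) hG
  push_cast [PowerSeries.coe_C, map_ofNat] at hZ hV hG ⊢
  linear_combination -2 * invX A ^ 2 * hZ + (2 * invX A * (U : A⸨X⸩) * (invX A * (X : A⟦X⟧) + 1) +
    2 * invX A * (X : A⟦X⟧) * (U : A⸨X⸩) * (S.zetaRegularDiff : A⸨X⸩) - 2 * invX A * (Z : A⸨X⸩) +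
    HahnSeries.C (D S.p) - (d⁄dX A S.wpRegular : A⟦X⟧) * invX A * (X : A⟦X⟧) *
      (invX A * (X : A⟦X⟧) + 1)) * hX - invX A * hG -
    invX A ^ 2 * (X : A⟦X⟧) * (G : A⸨X⸩) * hV - invX A * (G : A⸨X⸩) * hX

theorem C_deriv_p_sq : (HahnSeries.C (D S.p) : A⸨X⸩) ^ 2 = 4 * HahnSeries.C S.p ^ 3 -
    algebraMap k A⸨X⸩ S.g₂ * HahnSeries.C S.p - algebraMap k A⸨X⸩ S.g₃ := by
  simp only [HahnSeries.algebraMap_apply, ← map_pow, ← map_mul, ← map_ofNat HahnSeries.C,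
    ← map_sub, S.deriv_p_sq]

theorem C_deriv_deriv_p : (HahnSeries.C (D (D S.p)) : A⸨X⸩) =
    6 * HahnSeries.C S.p ^ 2 - algebraMap k A⸨X⸩ (S.g₂ / 2) := by
  simp only [HahnSeries.algebraMap_apply, ← map_pow, ← map_mul, ← map_ofNat HahnSeries.C,
    ← map_sub, S.deriv_deriv_p]

theorem additionDefect_derivation [CharZero k] :
    (HahnSeries.C S.p - S.wpSeries) *
      (laurentDeriv k A + coeffDerivation D) S.additionDefect =
    (laurentDeriv k A + coeffDerivation D) (HahnSeries.C S.p - S.wpSeries) *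
      S.additionDefect := by
  have hC (a : A) : (laurentDeriv k A + coeffDerivation D) (HahnSeries.C a) =
      HahnSeries.C (D a) := by
    rw [Derivation.add_apply, coeffDerivation_C, laurentDeriv_C, zero_add]
  have hw : (laurentDeriv k A + coeffDerivation D) S.wpSeries = laurentDeriv k A S.wpSeries := by
    rw [Derivation.add_apply, coeffDerivation_wpSeries, add_zero]
  have hdw : (laurentDeriv k A + coeffDerivation D) (laurentDeriv k A S.wpSeries) =
      6 * S.wpSeries ^ 2 - algebraMap k A⸨X⸩ (S.g₂ / 2) := by
    rw [Derivation.add_apply, ← laurentDeriv_coeffDerivation, coeffDerivation_wpSeries, map_zero,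
      add_zero, laurentDeriv_laurentDeriv_wpSeries]
  have h2 : (laurentDeriv k A + coeffDerivation D) (2 : A⸨X⸩) = 0 := by
    rw [← map_ofNat (algebraMap k A⸨X⸩) 2, Derivation.map_algebraMap]
  rw [additionDefect, map_sub, map_add, Derivation.leibniz, Derivation.leibniz, map_sub, hC, hC, hw,
    hdw, laurentDeriv_add_coeffDerivation_zetaDiff, h2]
  simp only [smul_eq_mul]
  linear_combination S.C_deriv_p_sq - S.laurentDeriv_wpSeries_sq -
    (HahnSeries.C S.p - S.wpSeries) *
      (S.C_deriv_deriv_p - two_mul_algebraMap_div_two (B := A⸨X⸩) S.g₂)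

theorem additionDefect_eq_zero [CharZero k] : S.additionDefect = 0 := by
  obtain ⟨q, hq₀, hq⟩ := S.exists_additionDefect_eq_mul
  suffices (q : A⸨X⸩) = 0 by rw [hq, this, mul_zero]
  refine eq_zero_of_laurentDeriv_add_eq_mul D (t := 0) (fun _ _ => rfl) (fun n hn => ?_) ?_
  · obtain hn | rfl := hn.lt_or_eq
    · exact coeff_coe_of_neg q hn
    · rw [← Int.natCast_zero, coeff_coe_powerSeries, coeff_zero_eq_constantCoeff_apply, hq₀]
  · have h := S.additionDefect_derivation
    rw [hq, Derivation.leibniz, smul_eq_mul, smul_eq_mul] at h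
    rw [zero_mul, ← Derivation.add_apply]
    refine (S.isUnit_C_sub_wpSeries.pow 2).mul_left_cancel ?_
    linear_combination h

theorem two_mul_C_sub_wpSeries_mul_zetaDiff [CharZero k] :
    2 * (HahnSeries.C S.p - S.wpSeries) * S.zetaDiff =
      HahnSeries.C (D S.p) + laurentDeriv k A S.wpSeries :=
  sub_eq_zero.mp S.additionDefect_eq_zero

theorem coeffDerivation_zetaDiff_add_sq [CharZero k] :
    coeffDerivation D S.zetaDiff + S.zetaDiff ^ 2 = 2 * HahnSeries.C S.p + S.wpSeries := by
  have h := S.two_mul_C_sub_wpSeries_mul_zetaDiff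
  have hD := congrArg (coeffDerivation D) h
  have h2 : coeffDerivation D (2 : A⸨X⸩) = 0 := by
    rw [← map_ofNat (algebraMap k A⸨X⸩) 2, Derivation.map_algebraMap]
  have h4 : IsUnit (4 : A⸨X⸩) := by
    rw [← map_ofNat (algebraMap k A⸨X⸩) 4]
    exact (IsUnit.mk0 (4 : k) (by norm_num)).map _
  rw [Derivation.leibniz, Derivation.leibniz, map_sub, coeffDerivation_C, map_add,
    coeffDerivation_C, coeffDerivation_wpSeries, ← laurentDeriv_coeffDerivation,
    coeffDerivation_wpSeries, map_zero, h2] at hD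
  simp only [smul_eq_mul] at hD
  refine (h4.mul (S.isUnit_C_sub_wpSeries.pow 2)).mul_left_cancel ?_
  linear_combination 2 * (HahnSeries.C S.p - S.wpSeries) * hD +
    (2 * (HahnSeries.C S.p - S.wpSeries) * S.zetaDiff - HahnSeries.C (D S.p) +
      laurentDeriv k A S.wpSeries) * h - S.C_deriv_p_sq + S.laurentDeriv_wpSeries_sq +
    2 * (HahnSeries.C S.p - S.wpSeries) * S.C_deriv_deriv_p -
    (HahnSeries.C S.p - S.wpSeries) * two_mul_algebraMap_div_two (B := A⸨X⸩) S.g₂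

/-- `V` is the expansion `σ(x - X) / σ(x) * exp ((ζ(X) - X⁻¹) x)`, characterised by its
logarithmic derivative in `X`. -/
structure IsWave (V : A⟦X⟧) : Prop where
  constantCoeff_eq : constantCoeff V = 1
  derivative_eq : d⁄dX A V = -(shift D S.z + C S.x * S.wpRegular) * V

theorem coeffDerivation_shift_z_add :
    coeffDerivation D ((shift D S.z + C S.x * S.wpRegular : A⟦X⟧) : A⸨X⸩) =
      (S.wpRegular - shift D S.p : A⟦X⟧) := by
  push_cast
  rw [map_add, coeffDerivation_shift, Derivation.leibniz, PowerSeries.coe_C, coeffDerivation_C,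
    wpRegular, coeffDerivation_map_algebraMap, S.deriv_z, S.deriv_x, map_neg, smul_zero, zero_add,
    map_one, smul_eq_mul, mul_one, map_neg, neg_add_eq_sub]

theorem IsWave.coeffDerivation_eq [CharZero k] {S : LameData D} {V : A⟦X⟧} (hV : S.IsWave V) :
    coeffDerivation D (V : A⸨X⸩) = S.zetaRegularDiff * V := by
  refine sub_eq_zero.mp (eq_zero_of_laurentDeriv_add_eq_mul (0 : Derivation k A A)
    (t := (-(shift D S.z + C S.x * S.wpRegular) : A⟦X⟧)) (fun n => coeff_coe_of_neg _)
    (fun n hn => ?_) ?_)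
  · rw [← map_mul, HahnSeries.coeff_sub, coeff_coeffDerivation]
    obtain hn | rfl := hn.lt_or_eq
    · rw [coeff_coe_of_neg _ hn, coeff_coe_of_neg _ hn, map_zero, sub_zero]
    · rw [← Int.natCast_zero, coeff_coe_powerSeries, coeff_coe_powerSeries,
        coeff_zero_eq_constantCoeff_apply, coeff_zero_eq_constantCoeff_apply, map_mul,
        hV.constantCoeff_eq, constantCoeff_zetaRegularDiff, D.map_one_eq_zero, zero_mul, sub_zero]
  · rw [coeffDerivation_zero, add_zero, map_sub, laurentDeriv_coeffDerivation, laurentDeriv_coe,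
      hV.derivative_eq, map_mul, map_neg, Derivation.leibniz, Derivation.leibniz, laurentDeriv_coe,
      laurentDeriv_coe, hV.derivative_eq, derivative_zetaRegularDiff, map_neg,
      coeffDerivation_shift_z_add]
    simp only [smul_eq_mul, map_mul, map_sub, map_neg]
    ring

theorem IsWave.del_mul_ofLaurent [CharZero k] {S : LameData D} {V : A⟦X⟧} (hV : S.IsWave V)
    (s : A⸨X⸩) : PseudoDiffOp.del D * ofLaurent D (s * V) =
      ofLaurent D ((coeffDerivation D s + S.zetaDiff * s) * V) := by
  rw [_root_.KPLame.del_mul_ofLaurent, Derivation.leibniz, hV.coeffDerivation_eq, zetaDiff]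
  congr 1
  simp only [smul_eq_mul]
  ring

end Field

end LameData

section TaylorSeries

/-- The Taylor series of a function at `0`; it represents the function near `0` only if the
function is analytic there. -/
def taylorSeries (f : ℂ → ℂ) : ℂ⟦X⟧ := .mk fun n => iteratedDeriv n f 0 / n.factorial

namespace taylorSeries

variable {f g : ℂ → ℂ}

theorem coeff_eq (f : ℂ → ℂ) (n : ℕ) :
    PowerSeries.coeff n (taylorSeries f) = iteratedDeriv n f 0 / n.factorial := coeff_mk _ _

theorem constantCoeff_eq (f : ℂ → ℂ) : constantCoeff (taylorSeries f) = f 0 := by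
  rw [← coeff_zero_eq_constantCoeff_apply, coeff_eq]
  simp

theorem congr (h : f =ᶠ[𝓝 0] g) : taylorSeries f = taylorSeries g := by
  ext n
  rw [coeff_eq, coeff_eq, h.iteratedDeriv_eq]

theorem add (hf : AnalyticAt ℂ f 0) (hg : AnalyticAt ℂ g 0) :
    taylorSeries (fun z => f z + g z) = taylorSeries f + taylorSeries g := by
  ext n
  rw [map_add, coeff_eq, coeff_eq, coeff_eq, ← add_div]
  exact congrArg (· / _) (iteratedDeriv_add hf.contDiffAt hg.contDiffAt)

theorem mul (hf : AnalyticAt ℂ f 0) (hg : AnalyticAt ℂ g 0) :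
    taylorSeries (fun z => f z * g z) = taylorSeries f * taylorSeries g := by
  ext n
  simp only [coeff_eq, iteratedDeriv_fun_mul hf.contDiffAt hg.contDiffAt, PowerSeries.coeff_mul,
    Finset.Nat.sum_antidiagonal_eq_sum_range_succ_mk, Nat.succ_eq_add_one, Finset.sum_div]
  refine Finset.sum_congr rfl fun i hi => ?_
  rw [Nat.cast_choose _ (Nat.lt_succ_iff.mp (Finset.mem_range.mp hi))]
  field_simp [Nat.factorial_ne_zero]

theorem const (c : ℂ) : taylorSeries (fun _ => c) = C c := by
  ext n
  rw [coeff_eq, coeff_C, iteratedDeriv_const]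
  split_ifs with h
  · simp [h]
  · exact zero_div _

theorem const_mul (c : ℂ) (f : ℂ → ℂ) :
    taylorSeries (fun z => c * f z) = C c * taylorSeries f := by
  ext n
  rw [coeff_C_mul, coeff_eq, coeff_eq, iteratedDeriv_const_mul_field, mul_div_assoc]

theorem neg (f : ℂ → ℂ) : taylorSeries (fun z => -f z) = -taylorSeries f := by
  simpa using const_mul (-1) f

theorem sub (hf : AnalyticAt ℂ f 0) (hg : AnalyticAt ℂ g 0) :
    taylorSeries (fun z => f z - g z) = taylorSeries f - taylorSeries g := by
  simp only [sub_eq_add_neg, add hf hg.fun_neg, neg]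

theorem pow (hf : AnalyticAt ℂ f 0) (m : ℕ) :
    taylorSeries (fun z => f z ^ m) = taylorSeries f ^ m := by
  induction m with
  | zero => simp only [pow_zero, const, map_one]
  | succ m ih => simp only [pow_succ, mul (hf.fun_pow m) hf, ih]

theorem pow_id (m : ℕ) : taylorSeries (fun z => z ^ m) = X ^ m := by
  ext n
  rw [coeff_eq, coeff_X_pow, iteratedDeriv_fun_pow_zero]
  split_ifs with h
  · exact h ▸ div_self (Nat.cast_ne_zero.mpr n.factorial_ne_zero)
  · rw [Nat.cast_zero, zero_div]

theorem deriv (f : ℂ → ℂ) : taylorSeries (deriv f) = d⁄dX ℂ (taylorSeries f) := by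
  ext n
  have h := Nat.cast_add_one_ne_zero (R := ℂ) n
  rw [coeff_derivative, coeff_eq, coeff_eq, iteratedDeriv_succ', Nat.factorial_succ]
  push_cast
  field_simp

theorem hasFPowerSeriesAt (hf : AnalyticAt ℂ f 0) : HasFPowerSeriesAt f
    (.ofScalars ℂ fun n => PowerSeries.coeff n (taylorSeries f)) 0 := by
  simpa only [coeff_eq] using hf.hasFPowerSeriesAt

theorem eventually_hasSum (hf : AnalyticAt ℂ f 0) : ∀ᶠ z in 𝓝 0,
    HasSum (fun n => PowerSeries.coeff n (taylorSeries f) * z ^ n) (f z) := by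
  filter_upwards [hasFPowerSeriesAt_iff.mp (hasFPowerSeriesAt hf)] with z hz
  simpa only [FormalMultilinearSeries.coeff_ofScalars, smul_eq_mul, mul_comm, zero_add] using hz

theorem eq_coeff_of_eventually_hasSum (hf : AnalyticAt ℂ f 0) {c : ℕ → ℂ}
    (hc : ∀ᶠ z in 𝓝[≠] 0, HasSum (fun n => c n * z ^ n) (f z)) (n : ℕ) :
    c n = PowerSeries.coeff n (taylorSeries f) := by
  obtain ⟨g, hg, hgf⟩ : ∃ g, HasFPowerSeriesAt g (.ofScalars ℂ c) 0 ∧ g =ᶠ[𝓝[≠] 0] f := by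
    refine ⟨Function.update f 0 (c 0), hasFPowerSeriesAt_iff.mpr ?_, ?_⟩
    · filter_upwards [eventually_nhdsWithin_iff.mp hc] with z hz
      simp only [FormalMultilinearSeries.coeff_ofScalars, smul_eq_mul, mul_comm, zero_add]
      obtain rfl | h0 := eq_or_ne z 0
      · rw [Function.update_self]
        convert! hasSum_single (f := fun n => c n * (0 : ℂ) ^ n) 0 fun n hn => by simp [hn]
        simp
      · rw [Function.update_of_ne h0]
        exact hz h0
    · filter_upwards [self_mem_nhdsWithin] with z hz using Function.update_of_ne hz _ _
  have hgf' := (hg.continuousAt.eventuallyEq_nhds_iff_eventuallyEq_nhdsNE hf.continuousAt).mp hgf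
  have h := congrArg (FormalMultilinearSeries.coeff · n)
    (hg.eq_formalMultilinearSeries_of_eventually (hasFPowerSeriesAt hf) hgf')
  simpa only [FormalMultilinearSeries.coeff_ofScalars] using h

end taylorSeries

end TaylorSeries

section WeierstrassP

variable (L : PeriodPair)

theorem eventually_mem_compl_diff : ∀ᶠ z in 𝓝 (0 : ℂ), z ∈ ((L.lattice : Set ℂ) \ {0})ᶜ :=
  L.compl_lattice_sdiff_singleton_mem_nhds 0

theorem weierstrassP_eq (z : ℂ) : L.weierstrassP z = 1 / z ^ 2 + L.weierstrassPExcept 0 z := by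
  simpa [add_comm] using (L.weierstrassPExcept_add 0 z).symm

theorem derivWeierstrassP_eq (z : ℂ) :
    L.derivWeierstrassP z = -2 / z ^ 3 + L.derivWeierstrassPExcept 0 z := by
  have h := L.derivWeierstrassPExcept_sub 0 z
  rw [ZeroMemClass.coe_zero, sub_zero] at h
  rw [← h]
  ring

theorem eventually_weierstrassPExcept_relation : ∀ᶠ z in 𝓝 (0 : ℂ),
    (z ^ 3 * deriv (L.weierstrassPExcept 0) z - 2) ^ 2 =
      4 * (1 + z ^ 2 * L.weierstrassPExcept 0 z) ^ 3 -
        L.g₂ * (z ^ 4 * (1 + z ^ 2 * L.weierstrassPExcept 0 z)) - L.g₃ * z ^ 6 := by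
  filter_upwards [eventually_mem_compl_diff L] with z hz
  rw [L.eqOn_deriv_weierstrassPExcept_derivWeierstrassPExcept 0 hz]
  obtain rfl | h0 := eq_or_ne z 0
  · norm_num
  · have key := L.derivWeierstrassP_sq z fun hm => hz ⟨hm, h0⟩
    rw [derivWeierstrassP_eq, weierstrassP_eq] at key
    field_simp at key
    linear_combination key

theorem mk_laurentCoeff : PowerSeries.mk L.laurentCoeff = taylorSeries (L.weierstrassPExcept 0) :=
  rfl

theorem mk_laurentCoeff_relation :
    (X ^ 3 * d⁄dX ℂ (.mk L.laurentCoeff) - 2) ^ 2 =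
      4 * (1 + X ^ 2 * .mk L.laurentCoeff) ^ 3 -
        C L.g₂ * X ^ 4 * (1 + X ^ 2 * .mk L.laurentCoeff) - C L.g₃ * X ^ 6 := by
  rw [mk_laurentCoeff]
  have h := taylorSeries.congr (eventually_weierstrassPExcept_relation L)
  have hp := L.analyticAt_weierstrassPExcept 0
  have hz (n : ℕ) : AnalyticAt ℂ (fun z : ℂ => z ^ n) 0 := analyticAt_id.fun_pow n
  have hc (c : ℂ) : AnalyticAt ℂ (fun _ : ℂ => c) 0 := analyticAt_const
  have hp' := (hz 3).fun_mul hp.deriv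
  have hs := (hc 1).fun_add ((hz 2).fun_mul hp)
  have h₃ := (hc 4).fun_mul (hs.fun_pow 3)
  have h₁ := (hc L.g₂).fun_mul ((hz 4).fun_mul hs)
  rw [taylorSeries.pow (hp'.fun_sub (hc 2)), taylorSeries.sub hp' (hc 2),
    taylorSeries.mul (hz 3) hp.deriv, taylorSeries.sub (h₃.fun_sub h₁) ((hc L.g₃).fun_mul (hz 6)),
    taylorSeries.sub h₃ h₁, taylorSeries.const_mul, taylorSeries.const_mul, taylorSeries.const_mul,
    taylorSeries.pow hs, taylorSeries.mul (hz 4) hs, taylorSeries.add (hc 1) ((hz 2).fun_mul hp),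
    taylorSeries.mul (hz 2) hp, taylorSeries.deriv] at h
  simp only [taylorSeries.const, taylorSeries.pow_id, map_one, map_ofNat] at h
  rw [h, mul_assoc (C L.g₂)]

theorem neg_one_pow_mul_laurentCoeff (n : ℕ) : (-1) ^ n * L.laurentCoeff n = L.laurentCoeff n := by
  have heven : (fun z => L.weierstrassPExcept 0 (-z)) = L.weierstrassPExcept 0 :=
    funext fun z => by rw [L.weierstrassPExcept_neg, neg_zero]
  have h := iteratedDeriv_comp_neg n (L.weierstrassPExcept 0) (0 : ℂ)
  rw [heven, neg_zero, smul_eq_mul] at h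
  rw [PeriodPair.laurentCoeff, ← mul_div_assoc, ← h]

theorem isPreconnected_compl_lattice : IsPreconnected ((L.lattice : Set ℂ)ᶜ) := by
  have : Countable L.lattice := L.latticeEquivProd.injective.countable
  refine ((Set.to_countable (L.lattice : Set ℂ)).isConnected_compl_of_one_lt_rank
    ?_).isPreconnected
  rw [Complex.rank_real_complex]
  norm_num

theorem exists_derivWeierstrassP_ne_zero : ∃ z ∉ L.lattice, L.derivWeierstrassP z ≠ 0 := by
  have hcont : ContinuousAt (fun z => -2 + z ^ 3 * L.derivWeierstrassPExcept 0 z) 0 :=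
    continuousAt_const.add ((continuousAt_id.pow 3).mul
      (L.analyticAt_derivWeierstrassPExcept 0).continuousAt)
  have hne : ∀ᶠ z in 𝓝[≠] (0 : ℂ), -2 + z ^ 3 * L.derivWeierstrassPExcept 0 z ≠ 0 :=
    (hcont.eventually_ne (by norm_num)).filter_mono nhdsWithin_le_nhds
  obtain ⟨z, ⟨hz, hm⟩, h0⟩ := ((hne.and ((eventually_mem_compl_diff L).filter_mono
    nhdsWithin_le_nhds)).and self_mem_nhdsWithin).exists
  have h0 : z ≠ 0 := h0
  refine ⟨z, fun h => hm ⟨h, h0⟩, fun h => hz ?_⟩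
  rw [derivWeierstrassP_eq] at h
  field_simp at h
  rw [h, mul_zero]

theorem hasDerivAt_weierstrassP {z : ℂ} (hz : z ∉ L.lattice) :
    HasDerivAt L.weierstrassP (L.derivWeierstrassP z) z := by
  rw [← L.deriv_weierstrassP]
  exact (L.analyticOnNhd_weierstrassP z hz).differentiableAt.hasDerivAt

theorem deriv_derivWeierstrassP_of_ne_zero {z : ℂ} (hz : z ∉ L.lattice)
    (h0 : L.derivWeierstrassP z ≠ 0) :
    deriv L.derivWeierstrassP z = 6 * L.weierstrassP z ^ 2 - L.g₂ / 2 := by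
  have h : (fun z => L.derivWeierstrassP z ^ 2) =ᶠ[𝓝 z]
      fun z => 4 * L.weierstrassP z ^ 3 - L.g₂ * L.weierstrassP z - L.g₃ := by
    filter_upwards [L.isClosed_lattice.isOpen_compl.mem_nhds hz] with u hu
      using L.derivWeierstrassP_sq u hu
  have hP := hasDerivAt_weierstrassP L hz
  have hP' := (L.analyticOnNhd_derivWeierstrassP z hz).differentiableAt.hasDerivAt
  have hd := h.deriv_eq
  rw [(hP'.fun_pow 2).deriv,
    ((((hP.fun_pow 3).const_mul 4).fun_sub (hP.const_mul L.g₂)).sub_const L.g₃).deriv] at hd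
  refine mul_left_cancel₀ (mul_ne_zero two_ne_zero h0) ?_
  push_cast at hd
  linear_combination hd

theorem deriv_derivWeierstrassP {z : ℂ} (hz : z ∉ L.lattice) :
    deriv L.derivWeierstrassP z = 6 * L.weierstrassP z ^ 2 - L.g₂ / 2 := by
  have hl : AnalyticOnNhd ℂ (deriv L.derivWeierstrassP) (L.lattice : Set ℂ)ᶜ :=
    L.analyticOnNhd_derivWeierstrassP.deriv
  have hr : AnalyticOnNhd ℂ (fun z => 6 * L.weierstrassP z ^ 2 - L.g₂ / 2)
      (L.lattice : Set ℂ)ᶜ := fun w hw =>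
    (analyticAt_const.fun_mul ((L.analyticOnNhd_weierstrassP w hw).fun_pow 2)).fun_sub
      analyticAt_const
  obtain ⟨w, hw, hw0⟩ := exists_derivWeierstrassP_ne_zero L
  refine hl.eqOn_of_preconnected_of_eventuallyEq hr (isPreconnected_compl_lattice L) hw ?_ hz
  filter_upwards [L.isClosed_lattice.isOpen_compl.mem_nhds hw,
    (L.analyticOnNhd_derivWeierstrassP w hw).continuousAt.eventually_ne hw0] with y hy hy0
    using deriv_derivWeierstrassP_of_ne_zero L hy hy0

end WeierstrassP

section SigmaFactor

/-- The term `1/(z - l) + 1/l + z/l²` of the sum defining `ζ` that belongs to the lattice point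
`l`, with the term for `l = 0` replaced by `0`. -/
def zetaTerm (l z : ℂ) : ℂ := if l = 0 then 0 else 1 / (z - l) + 1 / l + z / l ^ 2

/-- The factor of the product defining `σ` that belongs to the lattice point `l`. -/
def sigmaFactor (l z : ℂ) : ℂ :=
  (1 - z / l) * Complex.exp (z / l + z ^ 2 / (2 * l ^ 2))

theorem norm_zetaTerm_le {r : ℝ} {z l : ℂ} (hz : ‖z‖ < r) (hl : 2 * r ≤ ‖l‖) :
    ‖zetaTerm l z‖ ≤ 2 * r ^ 2 * ‖l‖⁻¹ ^ 3 := by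
  have hr : 0 < r := (norm_nonneg z).trans_lt hz
  have hl_pos : 0 < ‖l‖ := by linarith
  have hl0 : l ≠ 0 := norm_pos_iff.mp hl_pos
  have hzl : ‖l‖ / 2 ≤ ‖z - l‖ := by
    rw [norm_sub_rev]
    exact le_trans (by linarith) (norm_sub_norm_le l z)
  have hzl0 : z - l ≠ 0 := norm_pos_iff.mp (by linarith)
  have hterm : zetaTerm l z = z ^ 2 / (l ^ 2 * (z - l)) := by
    rw [zetaTerm, if_neg hl0]
    field_simp
    ring
  calc ‖zetaTerm l z‖ = ‖z‖ ^ 2 / (‖l‖ ^ 2 * ‖z - l‖) := by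
        rw [hterm, norm_div, norm_mul, norm_pow, norm_pow]
    _ ≤ r ^ 2 / (‖l‖ ^ 2 * (‖l‖ / 2)) := by gcongr
    _ = 2 * r ^ 2 * ‖l‖⁻¹ ^ 3 := by
        field_simp

theorem hasDerivAt_zetaTerm {l z : ℂ} (hz : l ≠ 0 → z ≠ l) :
    HasDerivAt (zetaTerm l) (-if l = 0 then 0 else 1 / (z - l) ^ 2 - 1 / l ^ 2) z := by
  unfold zetaTerm
  split_ifs with hl
  · simpa only [neg_zero] using! hasDerivAt_const z (0 : ℂ)
  · have h := ((((hasDerivAt_id z).sub_const l).fun_inv (sub_ne_zero.mpr (hz hl))).add_const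
      (1 / l)).fun_add ((hasDerivAt_id z).div_const (l ^ 2))
    simp only [id, inv_eq_one_div] at h
    convert! h using 1
    ring

theorem sigmaFactor_zero : sigmaFactor 0 = fun _ => 1 := by
  funext z
  simp [sigmaFactor]

theorem sigmaFactor_eq (l z : ℂ) : sigmaFactor l z =
    (1 - z / l) * Complex.exp (z / l + (z / l) ^ 2 / 2) := by
  rw [sigmaFactor, div_pow, div_div, mul_comm (l ^ 2)]

theorem differentiable_sigmaFactor (l : ℂ) : Differentiable ℂ (sigmaFactor l) := by
  unfold sigmaFactor
  fun_prop

theorem sigmaFactor_ne_zero {l z : ℂ} (hz : z ≠ l) : sigmaFactor l z ≠ 0 := by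
  refine mul_ne_zero (fun h => ?_) (Complex.exp_ne_zero _)
  obtain rfl | hl := eq_or_ne l 0
  · norm_num at h
  · rw [sub_eq_zero, eq_div_iff hl, one_mul] at h
    exact hz h.symm

theorem hasDerivAt_one_sub_mul_exp (u : ℂ) :
    HasDerivAt (fun u => (1 - u) * Complex.exp (u + u ^ 2 / 2))
      (-u ^ 2 * Complex.exp (u + u ^ 2 / 2)) u := by
  have hlin : HasDerivAt (fun u : ℂ => 1 - u) (-1) u := (hasDerivAt_id u).const_sub 1
  have hquad : HasDerivAt (fun u : ℂ => u + u ^ 2 / 2) (1 + u) u := by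
    convert! (hasDerivAt_id u).fun_add ((hasDerivAt_pow 2 u).div_const 2) using 1
    push_cast
    ring
  convert! hlin.fun_mul hquad.cexp using 1
  ring

theorem norm_one_sub_mul_exp_sub_one_le {u : ℂ} (hu : ‖u‖ ≤ 1) :
    ‖(1 - u) * Complex.exp (u + u ^ 2 / 2) - 1‖ ≤ Real.exp 2 * ‖u‖ ^ 3 := by
  have hderiv : ∀ v ∈ Metric.closedBall (0 : ℂ) ‖u‖,
      ‖-v ^ 2 * Complex.exp (v + v ^ 2 / 2)‖ ≤ Real.exp 2 * ‖u‖ ^ 2 := by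
    intro v hv
    rw [mem_closedBall_zero_iff] at hv
    rw [norm_mul, norm_neg, norm_pow, mul_comm]
    gcongr
    refine (Complex.norm_exp_le_exp_norm _).trans (Real.exp_le_exp.mpr ?_)
    refine (norm_add_le _ _).trans ?_
    rw [norm_div, norm_pow, Complex.norm_ofNat]
    nlinarith [norm_nonneg v, hv.trans hu]
  have h := (convex_closedBall (0 : ℂ) ‖u‖).norm_image_sub_le_of_norm_hasDerivWithin_le
    (fun v _ => (hasDerivAt_one_sub_mul_exp v).hasDerivWithinAt) hderiv
    (Metric.mem_closedBall_self (norm_nonneg u)) (mem_closedBall_zero_iff.mpr le_rfl)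
  convert! h using 1
  · norm_num
  · rw [sub_zero]
    ring

theorem norm_sigmaFactor_sub_one_le {r : ℝ} {z l : ℂ} (hz : ‖z‖ < r) (hl : r ≤ ‖l‖) :
    ‖sigmaFactor l z - 1‖ ≤ Real.exp 2 * r ^ 3 * ‖l‖⁻¹ ^ 3 := by
  have hl_pos : 0 < ‖l‖ := (norm_nonneg z).trans_lt (hz.trans_le hl)
  have hzl : ‖z / l‖ ≤ 1 := by
    rw [norm_div, div_le_one hl_pos]
    linarith
  calc ‖sigmaFactor l z - 1‖ ≤ Real.exp 2 * ‖z / l‖ ^ 3 := by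
        rw [sigmaFactor_eq]
        exact norm_one_sub_mul_exp_sub_one_le hzl
    _ = Real.exp 2 * ‖z‖ ^ 3 * ‖l‖⁻¹ ^ 3 := by
        rw [norm_div, div_eq_mul_inv, mul_pow, mul_assoc]
    _ ≤ Real.exp 2 * r ^ 3 * ‖l‖⁻¹ ^ 3 := by gcongr

theorem logDeriv_sigmaFactor {l z : ℂ} (hz : z ≠ l) :
    logDeriv (sigmaFactor l) z = zetaTerm l z := by
  obtain rfl | hl := eq_or_ne l 0
  · rw [sigmaFactor_zero, logDeriv_const, zetaTerm, if_pos rfl]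
    rfl
  have hderiv : HasDerivAt (sigmaFactor l)
      (-(z / l) ^ 2 * Complex.exp (z / l + (z / l) ^ 2 / 2) * (1 / l)) z := by
    rw [funext (sigmaFactor_eq l)]
    exact (hasDerivAt_one_sub_mul_exp (z / l)).comp z ((hasDerivAt_id z).div_const l)
  have hzl : z - l ≠ 0 := sub_ne_zero.mpr hz
  have hlz : l - z ≠ 0 := sub_ne_zero.mpr hz.symm
  rw [logDeriv_apply, hderiv.deriv, sigmaFactor_eq, zetaTerm, if_neg hl, mul_right_comm,
    mul_div_mul_right _ _ (Complex.exp_ne_zero _), one_sub_div hl]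
  field_simp
  ring

end SigmaFactor

section WeierstrassZeta

variable (L : PeriodPair)

/-- The function `ζ(z) - 1/z`, which is holomorphic at `0`. -/
def zetaRegular (z : ℂ) : ℂ := ∑' l : L.lattice, zetaTerm l z

theorem summable_norm_inv_pow_three : Summable fun l : L.lattice => ‖(l : ℂ)‖⁻¹ ^ 3 :=
  ZLattice.summable_norm_pow_inv _ 3 (by simp)

theorem hasSumLocallyUniformly_zetaRegular :
    HasSumLocallyUniformly (fun (l : L.lattice) z => zetaTerm l z) (zetaRegular L) := by
  refine L.hasSumLocallyUniformly_aux (u := fun r l => 2 * r ^ 2 * ‖(l : ℂ)‖⁻¹ ^ 3) _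
    (fun _ _ => (summable_norm_inv_pow_three L).mul_left _) fun r _ =>
    eventually_atTop.mpr ⟨2 * r, ?_⟩
  rintro _ h z hz l rfl
  exact norm_zetaTerm_le hz h

theorem hasSum_zetaRegular (z : ℂ) :
    HasSum (fun l : L.lattice => zetaTerm l z) (zetaRegular L z) :=
  (hasSumLocallyUniformly_zetaRegular L).hasSum

theorem ne_of_mem_compl_diff {z : ℂ} (hz : z ∈ ((L.lattice : Set ℂ) \ {0})ᶜ) (l : L.lattice)
    (hl : (l : ℂ) ≠ 0) : z ≠ l := by
  rintro rfl
  exact hz ⟨l.2, hl⟩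

theorem hasDerivAt_zetaRegular {z : ℂ} (hz : z ∈ ((L.lattice : Set ℂ) \ {0})ᶜ) :
    HasDerivAt (zetaRegular L) (-L.weierstrassPExcept 0 z) z := by
  have hopen := L.isOpen_compl_lattice_sdiff (s := {0})
  have hterm : ∀ w ∈ ((L.lattice : Set ℂ) \ {0})ᶜ, ∀ l : L.lattice, HasDerivAt (zetaTerm l) _ w :=
    fun w hw l => hasDerivAt_zetaTerm (ne_of_mem_compl_diff L hw l)
  have hdiff : ∀ᶠ s : Finset L.lattice in atTop, DifferentiableOn ℂ
      (fun z => ∑ l ∈ s, zetaTerm l z) ((L.lattice : Set ℂ) \ {0})ᶜ :=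
    .of_forall fun s => .fun_sum fun l _ w hw =>
      (hterm w hw l).differentiableAt.differentiableWithinAt
  have hsum := (hasSumLocallyUniformly_zetaRegular L).hasSumLocallyUniformlyOn
    (s := ((L.lattice : Set ℂ) \ {0})ᶜ)
  have hderiv : deriv (zetaRegular L) z = -L.weierstrassPExcept 0 z := by
    refine tendsto_nhds_unique ((TendstoLocallyUniformlyOn.deriv hsum hdiff hopen).tendsto_at hz)
      ((L.hasSum_weierstrassPExcept 0 z).neg.congr fun s => ?_)
    exact (HasDerivAt.fun_sum fun l _ => hterm z hz l).deriv.symm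
  rw [← hderiv]
  exact ((hsum.differentiableOn hdiff hopen).differentiableAt (hopen.mem_nhds hz)).hasDerivAt

theorem zetaRegular_zero : zetaRegular L 0 = 0 := by
  refine (tsum_congr fun l => ?_).trans tsum_zero
  rw [zetaTerm]
  split_ifs
  · rfl
  · rw [zero_sub, zero_div, div_neg, add_zero, neg_add_cancel]

theorem analyticAt_zetaRegular : AnalyticAt ℂ (zetaRegular L) 0 := by
  refine Complex.analyticAt_iff_eventually_differentiableAt.mpr ?_
  filter_upwards [eventually_mem_compl_diff L] with z hz
    using (hasDerivAt_zetaRegular L hz).differentiableAt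

theorem summable_weierstrassZeta (z : ℂ) :
    Summable fun l : L.lattice => 1 / (z - l) + 1 / (l : ℂ) + z / (l : ℂ) ^ 2 := by
  refine (hasSum_zetaRegular L z).summable.congr_cofinite
    ((Set.finite_singleton (0 : L.lattice)).subset fun l hl => ?_)
  by_contra h
  exact hl (if_neg fun h0 => h (Subtype.ext h0))

theorem weierstrassZeta_eq (z : ℂ) : L.weierstrassZeta z = 1 / z + zetaRegular L z := by
  rw [PeriodPair.weierstrassZeta,
    (summable_weierstrassZeta L z).tsum_eq_add_tsum_ite (0 : L.lattice), zetaRegular]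
  congr 1
  · simp
  · exact tsum_congr fun l => by simp only [zetaTerm, ← ZeroMemClass.coe_eq_zero]

theorem hasDerivAt_weierstrassZeta {z : ℂ} (hz : z ∉ L.lattice) :
    HasDerivAt L.weierstrassZeta (-L.weierstrassP z) z := by
  have hz0 : z ≠ 0 := fun h => hz (h ▸ L.lattice.zero_mem)
  have h := (hasDerivAt_inv hz0).fun_add (hasDerivAt_zetaRegular L (z := z) fun h => hz h.1)
  have hzeta : L.weierstrassZeta = fun z => z⁻¹ + zetaRegular L z :=
    funext fun z => by rw [weierstrassZeta_eq, one_div]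
  rw [hzeta, weierstrassP_eq]
  convert! h using 1
  ring

theorem differentiableOn_weierstrassZeta :
    DifferentiableOn ℂ L.weierstrassZeta (L.lattice : Set ℂ)ᶜ := fun _ hz =>
  (hasDerivAt_weierstrassZeta L hz).differentiableAt.differentiableWithinAt

end WeierstrassZeta

section WeierstrassSigma

variable (L : PeriodPair)

theorem eventually_norm_sigmaFactor_sub_one_le (r : ℝ) : ∀ᶠ l : L.lattice in cofinite,
    ∀ z ∈ Metric.ball (0 : ℂ) r,
      ‖sigmaFactor l z - 1‖ ≤ Real.exp 2 * r ^ 3 * ‖(l : ℂ)‖⁻¹ ^ 3 := by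
  refine (isCompact_iff_finite.mp (isCompact_closedBall (0 : L.lattice) r)).subset fun l hl => ?_
  by_contra h
  rw [Metric.mem_closedBall, dist_zero_right, not_le] at h
  exact hl fun z hz => norm_sigmaFactor_sub_one_le (mem_ball_zero_iff.mp hz) h.le

theorem hasProdLocallyUniformlyOn_sigmaFactor (r : ℝ) : HasProdLocallyUniformlyOn
    (fun (l : L.lattice) z => sigmaFactor l z) (fun z => ∏' l : L.lattice, sigmaFactor l z)
    (Metric.ball 0 r) := by
  have h := ((summable_norm_inv_pow_three L).mul_left
    (Real.exp 2 * r ^ 3)).hasProdLocallyUniformlyOn_one_add Metric.isOpen_ball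
    (eventually_norm_sigmaFactor_sub_one_le L r)
    (fun l => ((differentiable_sigmaFactor l).sub_const 1).continuous.continuousOn)
  simpa only [add_sub_cancel] using h

theorem differentiable_tprod_sigmaFactor :
    Differentiable ℂ fun z => ∏' l : L.lattice, sigmaFactor l z := fun z =>
  ((hasProdLocallyUniformlyOn_sigmaFactor L (‖z‖ + 1)).differentiableOn
    (.of_forall fun _ => by
      exact .fun_finsetProd fun (l : L.lattice) _ =>
        (differentiable_sigmaFactor (l : ℂ)).differentiableOn)
    Metric.isOpen_ball).differentiableAt
    (Metric.isOpen_ball.mem_nhds (mem_ball_zero_iff.mpr (lt_add_one _)))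

theorem summable_norm_sigmaFactor_sub_one (z : ℂ) :
    Summable fun l : L.lattice => ‖sigmaFactor l z - 1‖ := by
  refine Summable.of_norm_bounded_eventually ((summable_norm_inv_pow_three L).mul_left
    (Real.exp 2 * (‖z‖ + 1) ^ 3)) ?_
  filter_upwards [eventually_norm_sigmaFactor_sub_one_le L (‖z‖ + 1)] with l hl
  rw [norm_norm]
  exact hl z (mem_ball_zero_iff.mpr (lt_add_one _))

theorem ne_coe_of_notMem_lattice {z : ℂ} (hz : z ∉ L.lattice) (l : L.lattice) : z ≠ l :=
  fun h => hz (h ▸ l.2)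

theorem tprod_sigmaFactor_ne_zero {z : ℂ} (hz : z ∉ L.lattice) :
    ∏' l : L.lattice, sigmaFactor l z ≠ 0 := by
  have h := tprod_one_add_ne_zero_of_summable (f := fun l : L.lattice => sigmaFactor l z - 1)
    (fun l => by
      rw [add_sub_cancel]
      exact sigmaFactor_ne_zero (ne_coe_of_notMem_lattice L hz l))
    (summable_norm_sigmaFactor_sub_one L z)
  simpa only [add_sub_cancel] using h

theorem weierstrassSigma_ne_zero {z : ℂ} (hz : z ∉ L.lattice) : L.weierstrassSigma z ≠ 0 :=
  mul_ne_zero (ne_coe_of_notMem_lattice L hz 0) (tprod_sigmaFactor_ne_zero L hz)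

theorem differentiable_weierstrassSigma : Differentiable ℂ L.weierstrassSigma :=
  differentiable_id.fun_mul (differentiable_tprod_sigmaFactor L)

theorem logDeriv_weierstrassSigma {z : ℂ} (hz : z ∉ L.lattice) :
    logDeriv L.weierstrassSigma z = L.weierstrassZeta z := by
  have hfactor (l : L.lattice) : logDeriv (sigmaFactor l) z = zetaTerm l z :=
    logDeriv_sigmaFactor (ne_coe_of_notMem_lattice L hz l)
  have hprod := logDeriv_tprod_eq_tsum (f := fun (l : L.lattice) z => sigmaFactor l z)
    (Metric.isOpen_ball (x := (0 : ℂ)) (ε := ‖z‖ + 1))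
    (mem_ball_zero_iff.mpr (lt_add_one _))
    (fun l => sigmaFactor_ne_zero (ne_coe_of_notMem_lattice L hz l))
    (fun l => (differentiable_sigmaFactor (l : ℂ)).differentiableOn)
    ((hasSum_zetaRegular L z).summable.congr fun l => (hfactor l).symm)
    ⟨_, hasProdLocallyUniformlyOn_sigmaFactor L _⟩ (tprod_sigmaFactor_ne_zero L hz)
  rw [tsum_congr hfactor] at hprod
  change logDeriv (fun z => id z * ∏' l : L.lattice, sigmaFactor l z) z = _
  rw [logDeriv_mul z (ne_coe_of_notMem_lattice L hz 0) (tprod_sigmaFactor_ne_zero L hz)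
    differentiableAt_id (differentiable_tprod_sigmaFactor L z), hprod, logDeriv_id,
    weierstrassZeta_eq, zetaRegular]

theorem hasDerivAt_weierstrassSigma {z : ℂ} (hz : z ∉ L.lattice) :
    HasDerivAt L.weierstrassSigma (L.weierstrassZeta z * L.weierstrassSigma z) z := by
  rw [← logDeriv_weierstrassSigma L hz, logDeriv_apply,
    div_mul_cancel₀ _ (weierstrassSigma_ne_zero L hz)]
  exact (differentiable_weierstrassSigma L z).hasDerivAt

end WeierstrassSigma

section HolomorphicFun

variable {L : PeriodPair}

theorem derivation_apply_of_eq {f : L.holomorphicFun} {F : ℂ → ℂ}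
    (h : ∀ z : ((L.lattice : Set ℂ)ᶜ : Set ℂ), f.1 z = F z)
    (z : ((L.lattice : Set ℂ)ᶜ : Set ℂ)) : (L.derivation f).1 z = deriv F z :=
  L.deriv_extendZero h z

theorem iterate_derivation_apply_of_eq {f : L.holomorphicFun} {F : ℂ → ℂ}
    (h : ∀ z : ((L.lattice : Set ℂ)ᶜ : Set ℂ), f.1 z = F z) (n : ℕ)
    (z : ((L.lattice : Set ℂ)ᶜ : Set ℂ)) : (L.derivation^[n] f).1 z = iteratedDeriv n F z := by
  induction n generalizing z with
  | zero => rw [Function.iterate_zero_apply, h, iteratedDeriv_zero]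
  | succ n ih => rw [Function.iterate_succ_apply', derivation_apply_of_eq ih, iteratedDeriv_succ]

theorem derivation_wp_apply (z : ((L.lattice : Set ℂ)ᶜ : Set ℂ)) :
    (L.derivation L.wp).1 z = L.derivWeierstrassP z := by
  rw [derivation_apply_of_eq (F := L.weierstrassP) (fun _ => rfl), L.deriv_weierstrassP]

variable (L)

/-- The function `ζ` as a coefficient. -/
def zetaFun : L.holomorphicFun :=
  L.toHolomorphicFun L.weierstrassZeta (differentiableOn_weierstrassZeta L)

/-- The function `x` as a coefficient. -/
def coordFun : L.holomorphicFun := L.toHolomorphicFun id differentiableOn_id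

/-- The Weierstrass functions of `L` as a solution of the differential equations from which the
Lamé hierarchy is built. -/
def lameData : LameData L.derivation where
  p := L.wp
  z := zetaFun L
  x := coordFun L
  g₂ := L.g₂
  g₃ := L.g₃
  a := L.laurentCoeff
  deriv_z := Subtype.ext <| funext fun z =>
    (derivation_apply_of_eq (F := L.weierstrassZeta) (fun _ => rfl) z).trans
      (hasDerivAt_weierstrassZeta L z.2).deriv
  deriv_x := Subtype.ext <| funext fun z =>
    (derivation_apply_of_eq (F := id) (fun _ => rfl) z).trans (deriv_id _)
  deriv_p_sq := Subtype.ext <| funext fun z =>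
    (congrArg (· ^ 2) (derivation_wp_apply z)).trans (L.derivWeierstrassP_sq z z.2)
  deriv_deriv_p := Subtype.ext <| funext fun z =>
    (derivation_apply_of_eq derivation_wp_apply z).trans (deriv_derivWeierstrassP L z.2)
  even := neg_one_pow_mul_laurentCoeff L
  expansion := mk_laurentCoeff_relation L

variable {L}

/-- Evaluation at a point off the lattice. -/
def evalAt (x : ((L.lattice : Set ℂ)ᶜ : Set ℂ)) : L.holomorphicFun →+* ℂ :=
  (Pi.evalRingHom (fun _ : ((L.lattice : Set ℂ)ᶜ : Set ℂ) => ℂ) x).comp L.holomorphicFun.val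

theorem evalAt_apply (x : ((L.lattice : Set ℂ)ᶜ : Set ℂ)) (f : L.holomorphicFun) :
    evalAt x f = f.1 x := rfl

theorem evalAt_algebraMap (x : ((L.lattice : Set ℂ)ᶜ : Set ℂ)) (c : ℂ) :
    evalAt x (algebraMap ℂ _ c) = c := rfl

end HolomorphicFun

section BakerAkhiezer

variable (L : PeriodPair)

/-- The function `vHat` of `x` and `μ = λ⁻¹`, extended to `μ = 0`. -/
def vReg (x μ : ℂ) : ℂ :=
  L.weierstrassSigma (x - μ) / L.weierstrassSigma x * Complex.exp (zetaRegular L μ * x)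

theorem vHat_eq_vReg (x lam : ℂ) : L.vHat x lam = vReg L x lam⁻¹ := by
  rw [PeriodPair.vHat, vReg, weierstrassZeta_eq, one_div, inv_inv, add_sub_cancel_left]

theorem vReg_zero {x : ℂ} (hx : x ∉ L.lattice) : vReg L x 0 = 1 := by
  rw [vReg, zetaRegular_zero, sub_zero, zero_mul, Complex.exp_zero, mul_one,
    div_self (weierstrassSigma_ne_zero L hx)]

theorem analyticAt_vReg (x : ℂ) : AnalyticAt ℂ (vReg L x) 0 := by
  have hsigma : AnalyticAt ℂ (fun μ => L.weierstrassSigma (x - μ)) 0 :=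
    ((differentiable_weierstrassSigma L).comp (differentiable_id.const_sub x)).analyticAt 0
  exact (hsigma.div_const (c := L.weierstrassSigma x)).fun_mul
    ((analyticAt_zetaRegular L).fun_mul analyticAt_const).cexp

theorem deriv_vReg {x : ℂ} (hx : x ∉ L.lattice) : deriv (vReg L x) =ᶠ[𝓝 0] fun μ =>
    -(L.weierstrassZeta (x - μ) + x * L.weierstrassPExcept 0 μ) * vReg L x μ := by
  have hmem : ∀ᶠ μ in 𝓝 (0 : ℂ), x - μ ∉ L.lattice :=
    (continuous_const.sub continuous_id).continuousAt.eventually_mem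
      (L.isClosed_lattice.isOpen_compl.mem_nhds (by simpa using hx))
  filter_upwards [hmem, eventually_mem_compl_diff L] with μ hxμ hμ
  have hsigma := (hasDerivAt_weierstrassSigma L hxμ).comp_const_sub x μ
  have hexp := ((hasDerivAt_zetaRegular L hμ).mul_const x).cexp
  refine ((hsigma.div_const (L.weierstrassSigma x)).fun_mul hexp).deriv.trans ?_
  rw [vReg]
  ring

theorem analyticAt_weierstrassZeta_const_sub {x : ℂ} (hx : x ∉ L.lattice) :
    AnalyticAt ℂ (fun μ => L.weierstrassZeta (x - μ)) 0 := by
  have h : AnalyticAt ℂ L.weierstrassZeta (x - 0) := by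
    rw [sub_zero]
    exact (differentiableOn_weierstrassZeta L).analyticAt
      (L.isClosed_lattice.isOpen_compl.mem_nhds hx)
  exact h.comp_of_eq (analyticAt_const.fun_sub analyticAt_id) rfl

variable {L} in
theorem map_evalAt_shift {f : L.holomorphicFun} {F : ℂ → ℂ}
    (h : ∀ z : ((L.lattice : Set ℂ)ᶜ : Set ℂ), f.1 z = F z)
    (x : ((L.lattice : Set ℂ)ᶜ : Set ℂ)) :
    map (evalAt x) (shift L.derivation f) = taylorSeries fun μ => F (x - μ) := by
  ext n
  rw [taylorSeries.coeff_eq, iteratedDeriv_comp_const_sub, coeff_map, coeff_shift,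
    Algebra.smul_def, map_mul, evalAt_algebraMap, evalAt_apply, iterate_derivation_apply_of_eq h]
  simp only [sub_zero, smul_eq_mul, div_mul_eq_mul_div]

theorem map_evalAt_wpRegular (x : ((L.lattice : Set ℂ)ᶜ : Set ℂ)) :
    map (evalAt x) (lameData L).wpRegular = taylorSeries (L.weierstrassPExcept 0) := by
  ext n
  rw [LameData.wpRegular, coeff_map, coeff_map, evalAt_algebraMap, ← mk_laurentCoeff]
  rfl

variable {L} {V : L.holomorphicFun⟦X⟧}

theorem map_evalAt_eq_taylorSeries (hV : (lameData L).IsWave V)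
    (x : ((L.lattice : Set ℂ)ᶜ : Set ℂ)) : map (evalAt x) V = taylorSeries (vReg L x) := by
  have hzeta := analyticAt_weierstrassZeta_const_sub L x.2
  have hwp : AnalyticAt ℂ (fun μ => x * L.weierstrassPExcept 0 μ) 0 :=
    analyticAt_const.fun_mul (L.analyticAt_weierstrassPExcept 0)
  rw [← sub_eq_zero]
  refine eq_zero_of_derivative_eq_mul (t := -taylorSeries fun μ =>
    L.weierstrassZeta (x - μ) + x * L.weierstrassPExcept 0 μ) ?_ ?_
  · rw [map_sub, taylorSeries.constantCoeff_eq, vReg_zero L x.2,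
      ← coeff_zero_eq_constantCoeff_apply, coeff_map, coeff_zero_eq_constantCoeff_apply,
      hV.constantCoeff_eq, map_one, sub_self]
  · have hlhs : d⁄dX ℂ (map (evalAt x) V) = -(taylorSeries fun μ =>
        L.weierstrassZeta (x - μ) + x * L.weierstrassPExcept 0 μ) * map (evalAt x) V := by
      rw [← map_derivative, hV.derivative_eq, map_mul, map_neg, map_add, map_mul, map_C,
        map_evalAt_shift (F := L.weierstrassZeta) (fun _ => rfl), map_evalAt_wpRegular,
        taylorSeries.add hzeta hwp, taylorSeries.const_mul]
      rfl
    rw [map_sub, hlhs, ← taylorSeries.deriv, taylorSeries.congr (deriv_vReg L x.2),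
      taylorSeries.mul (hzeta.fun_add hwp).fun_neg (analyticAt_vReg L x), taylorSeries.neg,
      mul_sub]

theorem coeff_apply_eq_coeff_taylorSeries (hV : (lameData L).IsWave V)
    (x : ((L.lattice : Set ℂ)ᶜ : Set ℂ)) (n : ℕ) :
    (PowerSeries.coeff n V).1 x = PowerSeries.coeff n (taylorSeries (vReg L x)) := by
  rw [← map_evalAt_eq_taylorSeries hV, coeff_map, evalAt_apply]

theorem isExpansionOfVHat_iff_nhdsNE {v : ℕ → L.holomorphicFun} :
    L.IsExpansionOfVHat v ↔ ∀ x : ((L.lattice : Set ℂ)ᶜ : Set ℂ), ∀ᶠ μ in 𝓝[≠] (0 : ℂ),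
      HasSum (fun n => (v n).1 x * μ ^ n) (vReg L x μ) := by
  simp only [PeriodPair.IsExpansionOfVHat, vHat_eq_vReg, ← inv_cobounded₀]
  rfl

theorem isExpansionOfVHat_iff (hV : (lameData L).IsWave V) (v : ℕ → L.holomorphicFun) :
    L.IsExpansionOfVHat v ↔ v = fun n => PowerSeries.coeff n V := by
  rw [isExpansionOfVHat_iff_nhdsNE]
  refine ⟨fun h => funext fun n => Subtype.ext <| funext fun x => ?_, ?_⟩
  · rw [coeff_apply_eq_coeff_taylorSeries hV]
    exact taylorSeries.eq_coeff_of_eventually_hasSum (analyticAt_vReg L x) (h x) n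
  · rintro rfl x
    simp only [coeff_apply_eq_coeff_taylorSeries hV]
    exact (taylorSeries.eventually_hasSum (analyticAt_vReg L x)).filter_mono nhdsWithin_le_nhds

variable (L) in
theorem exists_isWave : ∃ V, (lameData L).IsWave V := by
  obtain ⟨V, hV₀, hV⟩ := exists_derivative_eq_mul
    (-(shift L.derivation (lameData L).z + C (lameData L).x * (lameData L).wpRegular))
  exact ⟨V, hV₀, hV⟩

end BakerAkhiezer

section OfSymbol

variable {k A : Type*} [CommRing k] [CommRing A] [Algebra k A] {D : Derivation k A A}

open PseudoDiffOp (ofSymbol ext_coeff)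

theorem hasOrderLE_ofSymbol (v : ℕ → A) : (ofSymbol D v).HasOrderLE 0 :=
  fun _ hn => if_neg hn.not_ge

theorem coeff_zero_ofSymbol (v : ℕ → A) : (ofSymbol D v).coeff 0 = v 0 := rfl

theorem coeffDeriv_ofSymbol_algebraMap (c : ℕ → k) :
    (ofSymbol D fun n => algebraMap k A (c n)).coeffDeriv = 0 := by
  refine ext_coeff fun n => ?_
  change D (if n ≤ 0 then _ else 0) = 0
  split_ifs
  exacts [D.map_algebraMap _, map_zero D]

end OfSymbol

namespace LameData

section Wave

variable {k A : Type*} [Field k] [CommRing A] [Algebra k A] {D : Derivation k A A}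
  (S : LameData D) {V : A⟦X⟧}

open PseudoDiffOp (del mulBy)

/-- The Laurent series `-℘'(X)/2`. -/
def wpHalfDeriv : A⸨X⸩ := -((1 / 2 : k) • laurentDeriv k A S.wpSeries)

/-- The symbols by which the Lamé operators `P_{n+2}` act on a wave. -/
def lameSymbol : ℕ → A⸨X⸩
  | 0 => S.wpSeries
  | 1 => S.wpHalfDeriv
  | n + 2 => S.wpSeries * lameSymbol n

theorem lameSymbol_two_mul (m : ℕ) : S.lameSymbol (2 * m) = S.wpSeries ^ (m + 1) := by
  induction m with
  | zero => rw [zero_add, pow_one]; rfl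
  | succ m ih => rw [pow_succ', ← ih]; rfl

theorem lameSymbol_two_mul_add_one (m : ℕ) :
    S.lameSymbol (2 * m + 1) = S.wpSeries ^ m * S.wpHalfDeriv := by
  induction m with
  | zero => rw [pow_zero, one_mul]; rfl
  | succ m ih => rw [pow_succ', mul_assoc, ← ih]; rfl

theorem coeffDerivation_wpHalfDeriv : coeffDerivation D S.wpHalfDeriv = 0 := by
  rw [wpHalfDeriv, map_neg, Derivation.map_smul, ← laurentDeriv_coeffDerivation,
    coeffDerivation_wpSeries, map_zero, smul_zero, neg_zero]

theorem coeffDerivation_lameSymbol (n : ℕ) : coeffDerivation D (S.lameSymbol n) = 0 := by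
  induction n using Nat.twoStepInduction with
  | zero => exact S.coeffDerivation_wpSeries
  | one => exact S.coeffDerivation_wpHalfDeriv
  | more n ih _ =>
    rw [lameSymbol, Derivation.leibniz, ih, coeffDerivation_wpSeries, smul_zero, smul_zero,
      add_zero]

theorem IsWave.isDressing {S : LameData D} (hV : S.IsWave V) :
    (ofLaurent D (V : A⸨X⸩)).IsDressing where
  hasOrderLE := by
    rw [ofLaurent_coe]
    exact hasOrderLE_ofSymbol _
  coeff_zero := by
    rw [ofLaurent_coe, coeff_zero_ofSymbol, coeff_zero_eq_constantCoeff_apply, hV.constantCoeff_eq]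

variable [CharZero k]

theorem p_mul_zetaDiff_sub : (HahnSeries.C S.p : A⸨X⸩) * S.zetaDiff -
    HahnSeries.C ((1 / 2 : k) • D S.p) = S.zetaDiff * S.wpSeries - S.wpHalfDeriv := by
  have h2 : (2 : A⸨X⸩) * algebraMap k A⸨X⸩ (1 / 2) = 1 := by
    rw [two_mul_algebraMap_div_two, map_one]
  have hC : HahnSeries.C ((1 / 2 : k) • D S.p) =
      algebraMap k A⸨X⸩ (1 / 2) * HahnSeries.C (D S.p) := by
    rw [Algebra.smul_def, map_mul, HahnSeries.algebraMap_apply]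
  rw [hC, wpHalfDeriv, Algebra.smul_def]
  linear_combination algebraMap k A⸨X⸩ (1 / 2) * S.two_mul_C_sub_wpSeries_mul_zetaDiff -
    (HahnSeries.C S.p - S.wpSeries) * S.zetaDiff * h2

variable {S}

theorem IsWave.del_sq_sub_mul (hV : S.IsWave V) :
    (del D ^ 2 - mulBy D (2 * S.p)) * ofLaurent D (V : A⸨X⸩) = ofLaurent D (S.wpSeries * V) := by
  have hdel : del D * ofLaurent D (V : A⸨X⸩) = ofLaurent D (S.zetaDiff * V) := by
    simpa using hV.del_mul_ofLaurent 1
  rw [sub_mul, sq, mul_assoc, hdel, hV.del_mul_ofLaurent, mulBy_mul_ofLaurent, ← map_sub, ← sq,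
    S.coeffDerivation_zetaDiff_add_sq, map_mul, map_ofNat]
  ring_nf

theorem IsWave.mulBy_mul_del_sub_mul (hV : S.IsWave V) :
    (mulBy D S.p * del D - mulBy D ((1 / 2 : k) • D S.p)) * ofLaurent D (V : A⸨X⸩) =
      ofLaurent D ((S.zetaDiff * S.wpSeries - S.wpHalfDeriv) * V) := by
  have hdel : del D * ofLaurent D (V : A⸨X⸩) = ofLaurent D (S.zetaDiff * V) := by
    simpa using hV.del_mul_ofLaurent 1
  rw [sub_mul, mul_assoc, hdel, mulBy_mul_ofLaurent, mulBy_mul_ofLaurent, ← map_sub,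
    ← S.p_mul_zetaDiff_sub, sub_mul, mul_assoc]

variable {P Q : PseudoDiffOp D} {s t : A⸨X⸩}

theorem IsWave.mul_del_add_coeffDeriv_sub_mul (hV : S.IsWave V) (hs : coeffDerivation D s = 0)
    (hP : P * ofLaurent D (V : A⸨X⸩) = ofLaurent D (s * V))
    (hQ : Q * ofLaurent D (V : A⸨X⸩) = ofLaurent D ((S.zetaDiff * s - t) * V)) :
    (P * del D + P.coeffDeriv - Q) * ofLaurent D (V : A⸨X⸩) = ofLaurent D (t * V) := by
  rw [← PseudoDiffOp.del_mul, sub_mul, mul_assoc, hP, hQ, hV.del_mul_ofLaurent, hs, ← map_sub]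
  ring_nf

theorem IsWave.mulBy_mul_sub_mul_del_sub_coeffDeriv_mul (hV : S.IsWave V)
    (hs : coeffDerivation D s = 0) (ht : coeffDerivation D t = 0)
    (hP : P * ofLaurent D (V : A⸨X⸩) = ofLaurent D (s * V))
    (hQ : Q * ofLaurent D (V : A⸨X⸩) = ofLaurent D ((S.zetaDiff * s - t) * V)) :
    (mulBy D (2 * S.p) * P - Q * del D - Q.coeffDeriv) * ofLaurent D (V : A⸨X⸩) =
      ofLaurent D ((S.zetaDiff * t - S.wpSeries * s) * V) := by
  rw [sub_sub, ← PseudoDiffOp.del_mul, sub_mul, mul_assoc, mul_assoc, hP, hQ,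
    hV.del_mul_ofLaurent, mulBy_mul_ofLaurent, ← map_sub, map_mul, map_ofNat,
    map_sub (coeffDerivation D), Derivation.leibniz, hs, ht]
  congr 1
  simp only [smul_eq_mul]
  linear_combination -s * V * S.coeffDerivation_zetaDiff_add_sq

end Wave

section SymbolU

variable {k A : Type*} [Field k] [CommRing A] [Algebra k A] {D : Derivation k A A}
  (S : LameData D)

/-- The symbol of the operator `U_{n+2}`. -/
def symbolU (n : ℕ) : A⸨X⸩ :=
  invX A ^ (n + 2) + (PowerSeries.map (algebraMap k A) (.mk fun m =>
    (-1) ^ m * ((m + n).factorial : k) / ((m.factorial : k) * ((n + 1).factorial : k)) *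
      S.a (m + n)) : A⟦X⟧)

theorem coeffDerivation_symbolU (n : ℕ) : coeffDerivation D (S.symbolU n) = 0 := by
  rw [symbolU, map_add, coeffDerivation_map_algebraMap, Derivation.leibniz_pow,
    coeffDerivation_invX, smul_zero, smul_zero, add_zero]

variable [CharZero k]

theorem symbolU_zero : S.symbolU 0 = S.wpSeries := by
  have hfac (m : ℕ) : (m.factorial : k) ≠ 0 := Nat.cast_ne_zero.mpr m.factorial_ne_zero
  simp [symbolU, wpSeries, wpRegular, hfac, S.even]

theorem laurentDeriv_symbolU (n : ℕ) :
    laurentDeriv k A (S.symbolU n) = (-(n + 2) : k) • S.symbolU (n + 1) := by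
  rw [symbolU, symbolU, map_add, Derivation.leibniz_pow, laurentDeriv_invX, laurentDeriv_coe,
    Algebra.smul_def (-(n + 2) : k), mul_add]
  congr 1
  · simp only [nsmul_eq_mul, smul_eq_mul, map_neg, map_add, map_natCast, map_ofNat]
    push_cast
    ring
  · rw [HahnSeries.algebraMap_apply, ← PowerSeries.coe_C, ← map_mul]
    congr 1
    ext m
    rw [coeff_derivative, coeff_map, coeff_mk, coeff_C_mul, coeff_map, coeff_mk, ← Nat.cast_succ,
      ← map_natCast (algebraMap k A), ← map_mul, ← map_mul]
    congr 1
    have h1 := Nat.cast_add_one_ne_zero (R := k) m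
    have h2 := Nat.cast_add_one_ne_zero (R := k) (n + 1)
    have h3 : m + 1 + n = m + (n + 1) := by ring
    rw [h3, Nat.factorial_succ m, Nat.factorial_succ (n + 1)]
    push_cast at h2 ⊢
    field_simp
    ring

theorem iterate_laurentDeriv_wpSeries (n : ℕ) : (laurentDeriv k A)^[n] S.wpSeries =
    ((-1) ^ n * ((n + 1).factorial : k)) • S.symbolU n := by
  induction n with
  | zero => simp [S.symbolU_zero]
  | succ n ih =>
    rw [Function.iterate_succ_apply', ih, Derivation.map_smul, laurentDeriv_symbolU, smul_smul,
      Nat.factorial_succ (n + 1)]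
    congr 1
    push_cast
    ring

end SymbolU

end LameData

section EvenDerivatives

open Polynomial (aeval derivative)

variable (L : PeriodPair)

theorem coeff_polyR_succ {m i : ℕ} (hi : m + 1 ≤ i) (h : ∀ j, m + 2 ≤ j → (L.polyR m).coeff j = 0) :
    (L.polyR (m + 1)).coeff i = ((i : ℂ) - 1) * (4 * i - 2) * (L.polyR m).coeff (i - 1) := by
  have hexpand : L.polyR (m + 1) =
      Polynomial.C 6 * (Polynomial.X ^ 2 * derivative (L.polyR m)) -
      Polynomial.C (L.g₂ / 2) * derivative (L.polyR m) +
      Polynomial.C 4 * (Polynomial.X ^ 3 * derivative (derivative (L.polyR m))) -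
      Polynomial.C L.g₂ * (Polynomial.X * derivative (derivative (L.polyR m))) -
      Polynomial.C L.g₃ * derivative (derivative (L.polyR m)) := by
    rw [PeriodPair.polyR, map_ofNat Polynomial.C 6, map_ofNat Polynomial.C 4]
    ring
  obtain ⟨i, rfl⟩ := Nat.exists_eq_add_of_le' (Nat.le_of_add_left_le hi)
  have hX₂ : (Polynomial.X ^ 2 * derivative (L.polyR m)).coeff (i + 1) =
      i * (L.polyR m).coeff i := by
    cases i <;> simp [Polynomial.coeff_X_pow_mul', Polynomial.coeff_derivative, mul_comm]
  have hX₃ : (Polynomial.X ^ 3 * derivative (derivative (L.polyR m))).coeff (i + 1) =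
      i * (i - 1) * (L.polyR m).coeff i := by
    obtain _ | _ | i := i
    · simp [Polynomial.coeff_X_pow_mul']
    · simp [Polynomial.coeff_X_pow_mul']
    · rw [Polynomial.coeff_X_pow_mul, Polynomial.coeff_derivative, Polynomial.coeff_derivative]
      push_cast
      ring
  rw [hexpand]
  simp only [Polynomial.coeff_add, Polynomial.coeff_sub, Polynomial.coeff_C_mul, hX₂, hX₃,
    Polynomial.coeff_X_mul, Polynomial.coeff_derivative, h (i + 1 + 1) (by omega),
    h (i + 1 + 1 + 1) (by omega), Nat.add_sub_cancel]
  push_cast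
  ring

theorem coeff_polyR {m i : ℕ} (hi : m ≤ i) :
    (L.polyR m).coeff i = if i = m + 1 then ((2 * m + 1).factorial : ℂ) else 0 := by
  induction m generalizing i with
  | zero => simp [PeriodPair.polyR, Polynomial.coeff_X, eq_comm]
  | succ m ih =>
    rw [coeff_polyR_succ L hi fun j hj => by rw [ih (by omega), if_neg (by omega)],
      ih (by omega)]
    obtain rfl | hi' := eq_or_ne i (m + 2)
    · rw [if_pos (by omega), if_pos rfl, Nat.mul_succ, Nat.add_right_comm,
        Nat.factorial_succ (2 * m + 1 + 1), Nat.factorial_succ (2 * m + 1)]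
      push_cast
      ring
    · rw [if_neg (by omega), if_neg (by omega), mul_zero]

/-- The monic polynomial `R_m / (2m + 1)!`, of degree `m + 1`. -/
def monicR (m : ℕ) : Polynomial ℂ := ((2 * m + 1).factorial : ℂ)⁻¹ • L.polyR m

theorem coeff_monicR (m j : ℕ) : (monicR L m).coeff j = L.coeffR m j := by
  rw [monicR, Polynomial.coeff_smul, smul_eq_mul, inv_mul_eq_div, PeriodPair.coeffR]

theorem polyR_eq_smul (m : ℕ) : L.polyR m = ((2 * m + 1).factorial : ℂ) • monicR L m :=
  (smul_inv_smul₀ (Nat.cast_ne_zero.mpr (2 * m + 1).factorial_ne_zero) _).symm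

theorem monicR_eq (m : ℕ) : monicR L m = Polynomial.X ^ (m + 1) +
    ∑ j ∈ Finset.Ico 1 m, L.coeffR m j • Polynomial.X ^ j + Polynomial.C (L.coeffR m 0) := by
  have hfac : ((2 * m + 1).factorial : ℂ) ≠ 0 := Nat.cast_ne_zero.mpr (Nat.factorial_ne_zero _)
  ext i
  simp only [coeff_monicR, Polynomial.coeff_add, Polynomial.coeff_X_pow, Polynomial.coeff_C,
    Polynomial.finsetSum_coeff, Polynomial.coeff_smul, smul_eq_mul, mul_ite, mul_one, mul_zero,
    Finset.sum_ite_eq, Finset.mem_Ico]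
  obtain hi | hi := le_or_gt m i
  · obtain rfl | h0 := eq_or_ne i 0
    · obtain rfl := Nat.le_zero.mp hi
      simp
    · rw [PeriodPair.coeffR, coeff_polyR L hi, if_neg (c := 1 ≤ i ∧ i < m) (by omega), if_neg h0,
        ite_div, div_self hfac, zero_div, add_zero, add_zero]
  · rw [if_neg (by omega)]
    obtain rfl | h0 := eq_or_ne i 0
    · rw [if_neg (by omega), if_pos rfl, add_zero, zero_add]
    · rw [if_pos (by omega), if_neg h0, zero_add, add_zero]

theorem derivative_monicR (m : ℕ) : derivative (monicR L m) =
    ((m : ℂ) + 1) • (Polynomial.X ^ m +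
      ∑ j ∈ Finset.Ico 1 m, ((j : ℂ) * L.coeffR m j / ((m : ℂ) + 1)) • Polynomial.X ^ (j - 1)) := by
  have hm : (m : ℂ) + 1 ≠ 0 := Nat.cast_add_one_ne_zero m
  rw [monicR_eq, Polynomial.derivative_add, Polynomial.derivative_add, Polynomial.derivative_C,
    Polynomial.derivative_X_pow, Polynomial.derivative_sum, add_zero, smul_add, Finset.smul_sum]
  congr 1
  · rw [Polynomial.smul_eq_C_mul]
    simp
  · refine Finset.sum_congr rfl fun j _ => ?_
    rw [Polynomial.derivative_smul, Polynomial.derivative_X_pow, smul_smul, mul_div_cancel₀ _ hm,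
      mul_comm (j : ℂ), mul_smul, Polynomial.smul_eq_C_mul (j : ℂ)]

variable {L} {B : Type*} [CommRing B] [Algebra ℂ B] {δ : Derivation ℂ B B} {w : B}

theorem iterate_two_mul_eq_aeval_polyR
    (hsq : δ w ^ 2 = 4 * w ^ 3 - algebraMap ℂ B L.g₂ * w - algebraMap ℂ B L.g₃)
    (hsecond : δ (δ w) = 6 * w ^ 2 - algebraMap ℂ B (L.g₂ / 2)) (m : ℕ) :
    δ^[2 * m] w = aeval w (L.polyR m) := by
  induction m with
  | zero => rw [PeriodPair.polyR, Polynomial.aeval_X]; rfl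
  | succ m ih =>
    rw [Nat.mul_succ, add_comm, Function.iterate_add_apply, ih, PeriodPair.polyR]
    simp only [Function.iterate_succ_apply, Function.iterate_zero_apply, Derivation.map_aeval,
      Derivation.leibniz, hsecond, map_add, map_sub, map_mul, map_pow, map_ofNat,
      Polynomial.aeval_C, Polynomial.aeval_X, smul_eq_mul]
    linear_combination aeval w (derivative (derivative (L.polyR m))) * hsq

theorem iterate_two_mul_add_one_eq_aeval_polyR
    (hsq : δ w ^ 2 = 4 * w ^ 3 - algebraMap ℂ B L.g₂ * w - algebraMap ℂ B L.g₃)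
    (hsecond : δ (δ w) = 6 * w ^ 2 - algebraMap ℂ B (L.g₂ / 2)) (m : ℕ) :
    δ^[2 * m + 1] w = aeval w (derivative (L.polyR m)) * δ w := by
  rw [Function.iterate_succ_apply', iterate_two_mul_eq_aeval_polyR hsq hsecond,
    Derivation.map_aeval, smul_eq_mul]

end EvenDerivatives

section LameOperators

open PseudoDiffOp (del mulBy ofSymbol differentialOperators mulBy_mem_differentialOperators
  del_mem_differentialOperators coeffDeriv_mem_differentialOperators)
open Polynomial (aeval derivative)

variable {L : PeriodPair} {V : L.holomorphicFun⟦X⟧}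

theorem opU_eq_ofLaurent (n : ℕ) : L.opU n = ofLaurent L.derivation ((lameData L).symbolU n) := by
  rw [PeriodPair.opU, LameData.symbolU, map_add, del_pow_eq_ofLaurent, ofLaurent_coe]
  simp only [coeff_map, coeff_mk]
  rfl

theorem constOp_mul_ofLaurent (c : ℂ) (s : L.holomorphicFun⸨X⸩) :
    L.constOp c * ofLaurent L.derivation s =
      ofLaurent L.derivation (algebraMap ℂ L.holomorphicFun⸨X⸩ c * s) :=
  algebraMap_mul_ofLaurent L.derivation c s

theorem lamePQ_mul (hV : (lameData L).IsWave V) (n : ℕ) :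
    (L.lamePQ n).1 * ofLaurent L.derivation V =
        ofLaurent L.derivation ((lameData L).lameSymbol n * V) ∧
      (L.lamePQ n).2 * ofLaurent L.derivation V = ofLaurent L.derivation
        (((lameData L).zetaDiff * (lameData L).lameSymbol n - (lameData L).lameSymbol (n + 1)) *
          V) := by
  induction n with
  | zero => exact ⟨hV.del_sq_sub_mul, hV.mulBy_mul_del_sub_mul⟩
  | succ n ih =>
    have hs := (lameData L).coeffDerivation_lameSymbol
    exact ⟨hV.mul_del_add_coeffDeriv_sub_mul (hs n) ih.1 ih.2,
      hV.mulBy_mul_sub_mul_del_sub_coeffDeriv_mul (hs n) (hs (n + 1)) ih.1 ih.2⟩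

theorem lameP_two_mul_mul (hV : (lameData L).IsWave V) {j : ℕ} (hj : 1 ≤ j) :
    L.lameP (2 * j) * ofLaurent L.derivation V =
      ofLaurent L.derivation ((lameData L).wpSeries ^ j * V) := by
  obtain ⟨j, rfl⟩ := Nat.exists_eq_add_of_le' hj
  rw [← LameData.lameSymbol_two_mul]
  exact (lamePQ_mul hV (2 * j)).1

theorem lameP_two_mul_add_one_mul (hV : (lameData L).IsWave V) {j : ℕ} (hj : 1 ≤ j) :
    L.lameP (2 * j + 1) * ofLaurent L.derivation V = ofLaurent L.derivation
      ((lameData L).wpSeries ^ (j - 1) * (lameData L).wpHalfDeriv * V) := by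
  obtain ⟨j, rfl⟩ := Nat.exists_eq_add_of_le' hj
  rw [Nat.add_sub_cancel, ← LameData.lameSymbol_two_mul_add_one]
  exact (lamePQ_mul hV (2 * j + 1)).1

theorem symbolU_two_mul (m : ℕ) :
    (lameData L).symbolU (2 * m) = aeval (lameData L).wpSeries (monicR L m) := by
  have hfac : ((2 * m + 1).factorial : ℂ) ≠ 0 := Nat.cast_ne_zero.mpr (Nat.factorial_ne_zero _)
  have h := iterate_two_mul_eq_aeval_polyR (lameData L).laurentDeriv_wpSeries_sq
    (lameData L).laurentDeriv_laurentDeriv_wpSeries m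
  rw [LameData.iterate_laurentDeriv_wpSeries, polyR_eq_smul, map_smul, pow_mul, neg_one_sq,
    one_pow, one_mul] at h
  exact (IsUnit.mk0 _ hfac).smul_left_cancel.mp h

theorem symbolU_two_mul_add_one (m : ℕ) : (lameData L).symbolU (2 * m + 1) =
    aeval (lameData L).wpSeries (((m : ℂ) + 1)⁻¹ • derivative (monicR L m)) *
      (lameData L).wpHalfDeriv := by
  have hfac : ((2 * m + 1).factorial : ℂ) ≠ 0 := Nat.cast_ne_zero.mpr (Nat.factorial_ne_zero _)
  have hm : (m : ℂ) + 1 ≠ 0 := Nat.cast_add_one_ne_zero m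
  have h := iterate_two_mul_add_one_eq_aeval_polyR (lameData L).laurentDeriv_wpSeries_sq
    (lameData L).laurentDeriv_laurentDeriv_wpSeries m
  rw [LameData.iterate_laurentDeriv_wpSeries, polyR_eq_smul, Polynomial.derivative_smul, map_smul,
    Nat.factorial_succ, pow_succ, pow_mul, neg_one_sq, one_pow, smul_mul_assoc] at h
  rw [map_smul, smul_mul_assoc, eq_inv_smul_iff₀ hm, LameData.wpHalfDeriv, mul_neg, mul_smul_comm]
  refine (IsUnit.mk0 _ hfac).smul_left_cancel.mp ?_
  push_cast at h
  linear_combination (norm := module) (-1 / 2 : ℂ) • h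

theorem tildeP_even_mul (hV : (lameData L).IsWave V) (m : ℕ) :
    L.tildeP (2 * m + 2) * ofLaurent L.derivation V =
      ofLaurent L.derivation ((lameData L).symbolU (2 * m) * V) := by
  have hm : (2 * m + 2) / 2 - 1 = m := by omega
  have htop : L.lameP (2 * m + 2) * ofLaurent L.derivation V =
      ofLaurent L.derivation ((lameData L).wpSeries ^ (m + 1) * V) := by
    simpa only [mul_add_one] using lameP_two_mul_mul hV (Nat.le_add_left 1 m)
  have hterm (j : ℕ) (hj : j ∈ Finset.Ico 1 m) :
      L.constOp (L.coeffR m j) * L.lameP (2 * j) * ofLaurent L.derivation V =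
        ofLaurent L.derivation
          (algebraMap ℂ L.holomorphicFun⸨X⸩ (L.coeffR m j) * (lameData L).wpSeries ^ j * V) := by
    rw [mul_assoc, lameP_two_mul_mul hV (Finset.mem_Ico.mp hj).1, constOp_mul_ofLaurent,
      mul_assoc]
  rw [PeriodPair.tildeP, if_pos (by simp [Nat.even_add]), hm, add_mul, add_mul, Finset.sum_mul,
    htop, Finset.sum_congr rfl hterm, constOp_mul_ofLaurent, ← map_sum, ← map_add, ← map_add,
    symbolU_two_mul, monicR_eq]
  simp only [map_add, map_sum, map_mul, map_pow, AlgHom.commutes, Polynomial.aeval_X,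
    Polynomial.aeval_C, add_mul, Finset.sum_mul, Algebra.smul_def]

theorem tildeP_odd_mul (hV : (lameData L).IsWave V) (m : ℕ) :
    L.tildeP (2 * m + 3) * ofLaurent L.derivation V =
      ofLaurent L.derivation ((lameData L).symbolU (2 * m + 1) * V) := by
  have hm : (2 * m + 3) / 2 - 1 = m := by omega
  have htop : L.lameP (2 * m + 3) * ofLaurent L.derivation V = ofLaurent L.derivation
      ((lameData L).wpSeries ^ m * (lameData L).wpHalfDeriv * V) := by
    simpa only [mul_add_one, add_assoc, Nat.add_sub_cancel] using
      lameP_two_mul_add_one_mul hV (Nat.le_add_left 1 m)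
  have hterm (j : ℕ) (hj : j ∈ Finset.Ico 1 m) :
      L.constOp (j * L.coeffR m j / (m + 1)) * L.lameP (2 * j + 1) * ofLaurent L.derivation V =
        ofLaurent L.derivation
          (algebraMap ℂ L.holomorphicFun⸨X⸩ (j * L.coeffR m j / (m + 1)) *
            (lameData L).wpSeries ^ (j - 1) * (lameData L).wpHalfDeriv * V) := by
    rw [mul_assoc, lameP_two_mul_add_one_mul hV (Finset.mem_Ico.mp hj).1, constOp_mul_ofLaurent,
      mul_assoc, mul_assoc, mul_assoc]
  have hodd : ¬ Even (2 * m + 3) := by simp [Nat.even_iff]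
  rw [PeriodPair.tildeP, if_neg hodd, hm, add_mul, Finset.sum_mul, htop,
    Finset.sum_congr rfl hterm, ← map_sum, ← map_add, symbolU_two_mul_add_one, derivative_monicR,
    inv_smul_smul₀ (Nat.cast_add_one_ne_zero m)]
  simp only [map_add, map_sum, map_mul, map_pow, AlgHom.commutes, Polynomial.aeval_X, add_mul,
    Finset.sum_mul, Algebra.smul_def]

theorem tildeP_mul (hV : (lameData L).IsWave V) (n : ℕ) :
    L.tildeP (n + 2) * ofLaurent L.derivation V = ofLaurent L.derivation V * L.opU n := by
  rw [opU_eq_ofLaurent, ofLaurent_mul_ofLaurent _ _ (LameData.coeffDerivation_symbolU _ n),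
    mul_comm]
  obtain ⟨m, rfl | rfl⟩ := n.even_or_odd'
  exacts [tildeP_even_mul hV m, tildeP_odd_mul hV m]

theorem lamePQ_mem_differentialOperators (n : ℕ) :
    (L.lamePQ n).1 ∈ differentialOperators L.derivation ∧
      (L.lamePQ n).2 ∈ differentialOperators L.derivation := by
  induction n with
  | zero =>
    exact ⟨sub_mem (pow_mem del_mem_differentialOperators 2) (mulBy_mem_differentialOperators _),
      sub_mem (mul_mem (mulBy_mem_differentialOperators _) del_mem_differentialOperators)
        (mulBy_mem_differentialOperators _)⟩
  | succ n ih =>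
    obtain ⟨hP, hQ⟩ := ih
    exact ⟨sub_mem (add_mem (mul_mem hP del_mem_differentialOperators)
        (coeffDeriv_mem_differentialOperators hP)) hQ,
      sub_mem (sub_mem (mul_mem (mulBy_mem_differentialOperators _) hP)
        (mul_mem hQ del_mem_differentialOperators)) (coeffDeriv_mem_differentialOperators hQ)⟩

theorem tildeP_mem_differentialOperators (n : ℕ) :
    L.tildeP n ∈ differentialOperators L.derivation := by
  have hP (j : ℕ) : L.lameP j ∈ differentialOperators L.derivation :=
    (lamePQ_mem_differentialOperators _).1
  have hc (c : ℂ) : L.constOp c ∈ differentialOperators L.derivation := algebraMap_mem _ c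
  rw [PeriodPair.tildeP]
  split_ifs
  · exact add_mem (add_mem (hP n) (sum_mem fun j _ => mul_mem (hc _) (hP _))) (hc _)
  · exact add_mem (hP n) (sum_mem fun j _ => mul_mem (hc _) (hP _))

end LameOperators

section Dressing

open PseudoDiffOp (del ofSymbol differentialOperators)

variable {L : PeriodPair} {V : L.holomorphicFun⟦X⟧} {W : L.PDO}

theorem conj_opU (hV : (lameData L).IsWave V) (hVW : ofLaurent L.derivation V * W = 1) (n : ℕ) :
    ofLaurent L.derivation V * L.opU n * W = L.tildeP (n + 2) := by
  rw [← tildeP_mul hV, mul_assoc, hVW, mul_one]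

theorem conj_opU_mem_differentialOperators (hV : (lameData L).IsWave V)
    (hVW : ofLaurent L.derivation V * W = 1) (n : ℕ) :
    ofLaurent L.derivation V * L.opU n * W ∈ differentialOperators L.derivation := by
  rw [conj_opU hV hVW]
  exact tildeP_mem_differentialOperators _

variable (L) in
/-- The part of order at most zero of `U_{n+2}`, that is, `U_{n+2} - ∂^{n+2}`. -/
def lowerU (n : ℕ) : L.PDO :=
  ofSymbol L.derivation fun m => algebraMap ℂ L.holomorphicFun
    ((-1) ^ m * ((m + n).factorial : ℂ) / ((m.factorial : ℂ) * ((n + 1).factorial : ℂ)) *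
      L.laurentCoeff (m + n))

theorem coeff_zero_lowerU (n : ℕ) : (lowerU L n).coeff 0 =
    algebraMap ℂ L.holomorphicFun (L.laurentCoeff n / ((n : ℂ) + 1)) := by
  have hn : (n.factorial : ℂ) ≠ 0 := Nat.cast_ne_zero.mpr n.factorial_ne_zero
  have hn1 : (n : ℂ) + 1 ≠ 0 := Nat.cast_add_one_ne_zero n
  refine (coeff_zero_ofSymbol _).trans (congrArg _ ?_)
  rw [zero_add, Nat.factorial_zero, Nat.factorial_succ]
  push_cast
  field_simp

theorem nonnegPart_pow_of_isWave (hV : (lameData L).IsWave V) (hW : W.IsDressing)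
    (hVW : ofLaurent L.derivation V * W = 1) (hWV : W * ofLaurent L.derivation V = 1) (n : ℕ) :
    ((ofLaurent L.derivation V * del L.derivation * W) ^ (n + 2)).nonnegPart =
      ofLaurent L.derivation V * L.opU n * W - L.constOp (L.laurentCoeff n / ((n : ℂ) + 1)) :=
  PseudoDiffOp.nonnegPart_conj_del_pow hV.isDressing hW hVW hWV (hasOrderLE_ofSymbol _)
    (coeff_zero_lowerU n) (conj_opU_mem_differentialOperators hV hVW n)

theorem isStationaryKP_of_isWave (hV : (lameData L).IsWave V) (hW : W.IsDressing)
    (hVW : ofLaurent L.derivation V * W = 1) (hWV : W * ofLaurent L.derivation V = 1) :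
    (ofLaurent L.derivation V * del L.derivation * W).IsStationaryKP :=
  PseudoDiffOp.isStationaryKP_conj_del hV.isDressing hW hVW hWV (fun _ => hasOrderLE_ofSymbol _)
    (fun _ => coeffDeriv_ofSymbol_algebraMap _) coeff_zero_lowerU
    (conj_opU_mem_differentialOperators hV hVW)

end Dressing

end KPLame

end

theorem mainTheorem2 (L : PeriodPair) :
    (∃! v : ℕ → L.holomorphicFun, L.IsExpansionOfVHat v) ∧
    ∀ v : ℕ → L.holomorphicFun, L.IsExpansionOfVHat v →
      let V₀ : L.PDO := PseudoDiffOp.ofSymbol L.derivation v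
      let L₀ : L.PDO := V₀ * PseudoDiffOp.del L.derivation * Ring.inverse V₀
      v 0 = 1 ∧ IsUnit V₀ ∧ L₀.IsStationaryKP ∧
      ∀ n : ℕ,
        (L₀ ^ (n + 2)).nonnegPart =
          L.tildeP (n + 2) - L.constOp (L.laurentCoeff n / ((n : ℂ) + 1)) ∧
        (L₀ ^ (n + 2)).nonnegPart =
          V₀ * L.opU n * Ring.inverse V₀ - L.constOp (L.laurentCoeff n / ((n : ℂ) + 1)) := by
  obtain ⟨V, hV⟩ := KPLame.exists_isWave L
  have hiff := KPLame.isExpansionOfVHat_iff hV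
  refine ⟨⟨_, (hiff _).mpr rfl, fun v => (hiff v).mp⟩, fun v hv => ?_⟩
  obtain ⟨W, hW, hVW, hWV⟩ := hV.isDressing.exists_inverse
  have hnonneg := KPLame.nonnegPart_pow_of_isWave hV hW hVW hWV
  have hinv : Ring.inverse (KPLame.ofLaurent L.derivation V) = W :=
    Ring.inverse_unit ⟨_, W, hVW, hWV⟩
  intro V₀ L₀
  have hV₀ : V₀ = KPLame.ofLaurent L.derivation V := by
    rw [KPLame.ofLaurent_coe, ← (hiff v).mp hv]
  have hL₀ : L₀ = KPLame.ofLaurent L.derivation V * PseudoDiffOp.del L.derivation * W := by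
    rw [← hinv, ← hV₀]
  rw [hL₀, hV₀, hinv]
  refine ⟨?_, ⟨⟨_, W, hVW, hWV⟩, rfl⟩, KPLame.isStationaryKP_of_isWave hV hW hVW hWV,
    fun n => ⟨?_, hnonneg n⟩⟩
  · rw [(hiff v).mp hv]
    exact (PowerSeries.coeff_zero_eq_constantCoeff_apply V).trans hV.constantCoeff_eq
  · rw [hnonneg, KPLame.conj_opU hV hVW]
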